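/- **Network.** Let $N=G\sqcup L$ be a finite set of buses ($G$: buses with inertia, $L$: buses without), $(N,E)$ a connected graph with arbitrarily oriented edges (power lines) and $(N,\tilde E)$ a connected communication graph. Let $M_j,\tau_{\chi,j}>0$ ($j\in G$), $\gamma_j>0$ ($j\in N$), $B_{ij}>0$ ($(i,j)\in E$), $\gamma_{ij}>0$ ($(i,j)\in\tilde E$), $p^L_j, p^{nom}_{ij}\in\mathbb R$ be constants. Consider the system $$\dot\eta_{ij}=\omega_i-\omega_j,\quad p_{ij}=B_{ij}\sin\eta_{ij}-p^{nom}_{ij}\quad ((i,j)\in E),$$ $$M_j\dot\omega_j=-p^L_j+s_j-d^u_j-\sum_{k:j\to k}p_{jk}+\sum_{i:i\to j}p_{ij}\ (j\in G),\qquad 0=-p^L_j+s_j-d^u_j-\sum_{k:j\to k}p_{jk}+\sum_{i:i\to j}p_{ij}\ (j\in L),$$ with net supply $s_j=p^M_j-d^c_j$ ($j\in G$), $s_j=-d^c_j$ ($j\in L$), and with the observer-based power command $$\gamma_{ij}\dot\psi_{ij}=p^c_i-p^c_j\ ((i,j)\in\tilde E),\qquad \gamma_j\dot p^c_j=-(s_j-\chi_j)-\sum_{k:j\to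 k}\psi_{jk}+\sum_{i:i\to j}\psi_{ij}\ (j\in N),$$ $$\tau_{\chi,j}\dot\chi_j=b_j-\omega_j-p^c_j-\chi_j\ (j\in G),\qquad M_j\dot b_j=-\chi_j+s_j-d^u_j-\sum_{k:j\to k}p_{jk}+\sum_{i:i\to j}p_{ij}\ (j\in G),$$ $$0=-\chi_j+s_j-d^u_j-\sum_{k:j\to k}p_{jk}+\sum_{i:i\to j}p_{ij}\ (j\in L).$$ With $\zeta_j=(-\omega_j,p^c_j)$, the quantities $p^M_j$ ($j\in G$), $d^c_j$ and $-d^u_j$ ($j\in N$) are outputs of finite-dimensional systems $\dot x=f(x,u)$, $y=g(x,u)$ ($f$ locally Lipschitz, $g$ continuous) with states $x^{M,j},x^{c,j},x^{u,j}$ and inputs $\zeta_j$, $\zeta_j$ and $-\omega_j$ respectively. For each constant input $\bar u$ such a system has a unique equilibrium $k_x(\bar u)$, which is locally asymptotically stable; $k_y(\bar u)=g(k_x(\bar u),\bar u)$ is its static characteristic, written $k_{p^M_j}$, $k_{d^c_j}$, $k_{d^u_j}$ (the last from $-\omega_j$ to $-d^u_j$). **OSLC problem.** Minimize $\sum_{j\in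 G}C_j(p^M_j)+\sum_{j\in N}C_{dj}(d^c_j)$ subject to $\sum_{j\in G}p^M_j=\sum_{j\in N}(d^c_j+p^L_j)$, $p^{M,min}_j\le p^M_j\le p^{M,max}_j$, $d^{c,min}_j\le d^c_j\le d^{c,max}_j$. **Assumptions.** (1) All $C_j,C_{dj}$ are continuously differentiable and strictly convex. (2) There is a surjective $f:\mathbb R^2\to\mathbb R$, strictly increasing in $p^c$, such that, with $[q]_a^b=\max\{\min\{q,b\},a\}$, $k_{p^M_j}(\zeta)=[(C_j')^{-1}(f(\zeta))]_{p^{M,min}_j}^{p^{M,max}_j}$ and $k_{d^c_j}(\zeta)=[(C_{dj}')^{-1}(-f(\zeta))]_{d^{c,min}_j}^{d^{c,max}_j}$ for all $\zeta\in\mathbb R^2$. (3) $u\,k_{d^u_j}(u)>0$ for all $u\ne0$ and $j\in N$. Let $z^*$ be an equilibrium of the system (values at it carry a star) such that: (4) $|\eta^*_{ij}|<\pi/2$ for all $(i,j)\in E$. (5) Near $z^*$, the power balance at the load buses determines $\omega^L=(\omega_j)_{j\in L}$ as a locally Lipschitz function of $(\eta,\omega^G,x^c,x^u,p^c)$, where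 $\omega^G=(\omega_j)_{j\in G}$. (6) For each $j\in N$ there is $\phi_j:\mathbb R^2\to\mathbb R$ such that the system with input $\zeta_j$, output $(s_j,-d^u_j)$ and state $(x^{M,j},x^{c,j},x^{u,j})$ (without $x^{M,j}$ if $j\in L$) has a continuously differentiable storage function $V$, locally positive definite about the equilibrium state (so with a strict local minimum there), with $$\dot V\le (s_j-s^*_j)\big[(-\omega_j+\omega_j^*)+(p^c_j-p^{c,*}_j)\big]+(-d^u_j+d^{u,*}_j)(-\omega_j+\omega_j^*)-\phi_j(\zeta_j-\zeta_j^*)$$ for all inputs and states near their equilibrium values; moreover either (a) $\phi_j$ is positive definite, or (b) $\phi_j\ge0$, $\phi_j$ is positive (hence nonzero) whenever its $\omega_j$-component is nonzero, and along solutions of the supply dynamics at bus $j$ that stay near the equilibrium, whenever $\omega_j$ and $s_j$ are constant for all $t\ge 0$, $p^c_j$ is not a nontrivial sinusoid (a nonconstant finite sum $\sum_kA_k\sin(\nu_kt+\theta_k)$). (7) If (a) holds at no bus, then for each of the systems generating $p^M_j$ and $d^c_j$ the regions of attraction of $k_x(\zeta)$ for all constant inputs $\zeta$ near $\zeta_j^*$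 contain a common neighborhood of $k_x(\zeta_j^*)$. **Conclusion.** There is an open neighborhood of $z^*$ such that from every point of it that satisfies the algebraic equations there starts a solution defined for all $t\ge0$; every solution on a bounded interval $[0,\tau)$ starting in it extends to $[0,\infty)$; and every solution on $[0,\infty)$ starting in it converges to the set of equilibria that have $\omega=0$ and whose $(p^M,d^c)$ is a global minimum of the OSLC problem. Along such a solution, $\omega(t)\to0$ and $(p^M(t),d^c(t))$ converges to a global minimum of the OSLC problem. -/

import Mathlib

open Set Filter Topology

noncomputable section

/-- Local asymptotic stability of the point `xb` for the autonomous equation `x' = F x`: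
Lyapunov stability (for solutions on any interval `[0, τ)`, so that finite escape is excluded)
and local attractivity. -/
def LocallyAsymptoticallyStable {X : Type*} [NormedAddCommGroup X] [NormedSpace ℝ X]
    (F : X → X) (xb : X) : Prop :=
  (∀ ε > 0, ∃ δ > 0, ∀ τ > 0, ∀ x : ℝ → X,
    (∀ t ∈ Ico (0 : ℝ) τ, HasDerivWithinAt x (F (x t)) (Ico 0 τ) t) →
    dist (x 0) xb < δ → ∀ t ∈ Ico (0 : ℝ) τ, dist (x t) xb < ε) ∧
  (∃ δ > 0, ∀ x : ℝ → X,
    (∀ t ∈ Ici (0 : ℝ), HasDerivWithinAt x (F (x t)) (Ici 0) t) →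
    dist (x 0) xb < δ → Tendsto x atTop (𝓝 xb))

/-- An input/state/output system `x' = f (x, u)`, `y = g (x, u)` with scalar output, `f` locally
Lipschitz and `g` continuous, such that for every constant input `u` there is a unique equilibrium
`kx u`, and this equilibrium is locally asymptotically stable. -/
structure IOSystem (U : Type) [NormedAddCommGroup U] where
  /-- the dimension of the state space -/
  dim : ℕ
  f : EuclideanSpace ℝ (Fin dim) × U → EuclideanSpace ℝ (Fin dim)
  g : EuclideanSpace ℝ (Fin dim) × U → ℝ
  f_lip : LocallyLipschitz f
  g_cont : Continuous g
  /-- the static input-state characteristic -/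
  kx : U → EuclideanSpace ℝ (Fin dim)
  f_kx : ∀ u, f (kx u, u) = 0
  kx_unique : ∀ u x, f (x, u) = 0 → x = kx u
  kx_stable : ∀ u, LocallyAsymptoticallyStable (fun x => f (x, u)) (kx u)

namespace IOSystem

variable {U : Type} [NormedAddCommGroup U]

/-- The state space of the system. -/
abbrev X (S : IOSystem U) : Type := EuclideanSpace ℝ (Fin S.dim)

/-- The static input-output characteristic. -/
def ky (S : IOSystem U) (u : U) : ℝ := S.g (S.kx u, u)

/-- The regions of attraction belonging to the constant inputs close to `ub` contain a common
neighborhood of the equilibrium `kx ub`. -/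
def CommonBasin (S : IOSystem U) (ub : U) : Prop :=
  ∃ A ∈ 𝓝 ub, ∃ X₀ ∈ 𝓝 (S.kx ub), ∀ u ∈ A, ∀ x : ℝ → S.X,
    (∀ t ∈ Ici (0 : ℝ), HasDerivWithinAt x (S.f (x t, u)) (Ici 0) t) →
    x 0 ∈ X₀ → Tendsto x atTop (𝓝 (S.kx u))

end IOSystem

/-- Local dissipativity of `x' = f (x, u)`, `y = g (x, u)` about the constant input `ub` and the
state `xb`, with supply rate `W`: there is a continuously differentiable storage function `V`
that is locally positive definite about `xb` (so `xb` is a strict local minimum) and satisfies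
`V' ≤ W (u, y)` for `u` near `ub` and `x` near `xb`. -/
def LocallyDissipative {X U Y : Type*} [NormedAddCommGroup X] [NormedSpace ℝ X]
    [TopologicalSpace U] (f : X × U → X) (g : X × U → Y) (ub : U) (xb : X)
    (W : U → Y → ℝ) : Prop :=
  ∃ (V : X → ℝ) (A : Set U) (B : Set X), ContDiff ℝ 1 V ∧
    IsOpen A ∧ ub ∈ A ∧ IsOpen B ∧ xb ∈ B ∧
    V xb = 0 ∧ (∀ᶠ x in 𝓝[≠] xb, 0 < V x) ∧
    ∀ u ∈ A, ∀ x ∈ B, fderiv ℝ V x (f (x, u)) ≤ W u (g (x, u))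

/-- A finite sum of sinusoids which is not a constant function. -/
def IsNontrivialSinusoid (p : ℝ → ℝ) : Prop :=
  (∃ (n : ℕ) (A ν θ : Fin n → ℝ), ∀ t, p t = ∑ k, A k * Real.sin (ν k * t + θ k)) ∧
  ¬ ∃ c, ∀ t, p t = c

/-- For the system `x' = f (x, ζ)` with input `ζ = (-ω, p)` and output `s (x, ζ)`: along solutions
that stay near `(xb, ζb)`, if `ω` and the output are constant for all times then `p` is not
a nontrivial sinusoid. -/
def NoSinusoid {X : Type*} [NormedAddCommGroup X] [NormedSpace ℝ X]
    (f : X × (ℝ × ℝ) → X) (s : X × (ℝ × ℝ) → ℝ) (ζb : ℝ × ℝ) (xb : X) : Prop :=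
  ∃ A ∈ 𝓝 ζb, ∃ B ∈ 𝓝 xb, ∀ (ω₀ s₀ : ℝ) (p : ℝ → ℝ) (x : ℝ → X),
    (∀ t ∈ Ici (0 : ℝ), (-ω₀, p t) ∈ A ∧ x t ∈ B) →
    (∀ t ∈ Ici (0 : ℝ), HasDerivWithinAt x (f (x t, (-ω₀, p t))) (Ici 0) t) →
    (∀ t ∈ Ici (0 : ℝ), s (x t, (-ω₀, p t)) = s₀) →
    ¬ IsNontrivialSinusoid p

/-- Positive definiteness of a function of `ζ = (-ω, p)`. -/
def PosDefFun (φ : ℝ × ℝ → ℝ) : Prop := φ 0 = 0 ∧ ∀ ζ, ζ ≠ 0 → 0 < φ ζ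

/-- Positive semidefiniteness, together with positive definiteness with respect to the first
component, of a function of `ζ = (-ω, p)`. -/
def PosDefFstFun (φ : ℝ × ℝ → ℝ) : Prop :=
  (∀ ζ, 0 ≤ φ ζ) ∧ (∀ ζ, φ ζ = 0 → ζ.1 = 0) ∧ (∀ ζ, ζ.1 ≠ 0 → 0 < φ ζ)

/-- The data of the power network. The buses are `G ⊕ L`: buses with inertia `G`, buses without
inertia `L`. -/
structure PowerNetwork (G L : Type) [Fintype G] [Fintype L] [DecidableEq G] [DecidableEq L] where
  /-- transmission lines, with an arbitrary orientation -/
  E : Finset ((G ⊕ L) × (G ⊕ L))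
  E_oriented : ∀ i j, (i, j) ∈ E → (j, i) ∉ E
  E_connected : (SimpleGraph.fromRel fun i j => (i, j) ∈ E).Connected
  /-- communication lines -/
  Ec : Finset ((G ⊕ L) × (G ⊕ L))
  Ec_connected : (SimpleGraph.fromRel fun i j => (i, j) ∈ Ec).Connected
  /-- inertia -/
  M : G → ℝ
  M_pos : ∀ j, 0 < M j
  /-- line susceptances -/
  B : E → ℝ
  B_pos : ∀ e, 0 < B e
  /-- nominal power transfers -/
  pnom : E → ℝ
  /-- uncontrollable frequency independent demand -/
  pL : G ⊕ L → ℝ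
  /-- time constants of the power command -/
  γ : G ⊕ L → ℝ
  γ_pos : ∀ j, 0 < γ j
  γc : Ec → ℝ
  γc_pos : ∀ e, 0 < γc e
  /-- time constants of the observer -/
  τ : G → ℝ
  τ_pos : ∀ j, 0 < τ j
  /-- generation: input `(-ω, p^c)`, output `p^M` -/
  sysM : G → IOSystem (ℝ × ℝ)
  /-- controllable demand: input `(-ω, p^c)`, output `d^c` -/
  sysC : G ⊕ L → IOSystem (ℝ × ℝ)
  /-- uncontrollable frequency dependent demand: input `-ω`, output `-d^u` -/
  sysU : G ⊕ L → IOSystem ℝ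

namespace PowerNetwork

variable {G L : Type} [Fintype G] [Fintype L] [DecidableEq G] [DecidableEq L]

/-- The variables of the closed loop system. -/
@[ext]
structure State (P : PowerNetwork G L) where
  η : P.E → ℝ
  ψ : P.Ec → ℝ
  ω : G ⊕ L → ℝ
  xM : ∀ j : G, (P.sysM j).X
  xC : ∀ j : G ⊕ L, (P.sysC j).X
  xU : ∀ j : G ⊕ L, (P.sysU j).X
  pc : G ⊕ L → ℝ
  b : G → ℝ
  χ : G ⊕ L → ℝ

variable (P : PowerNetwork G L)

namespace State

/-- The state as a tuple. -/
def toProd {P : PowerNetwork G L} (z : P.State) :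
    (P.E → ℝ) × (P.Ec → ℝ) × (G ⊕ L → ℝ) × (∀ j : G, (P.sysM j).X) ×
      (∀ j : G ⊕ L, (P.sysC j).X) × (∀ j : G ⊕ L, (P.sysU j).X) × (G ⊕ L → ℝ) × (G → ℝ) ×
      (G ⊕ L → ℝ) :=
  (z.η, z.ψ, z.ω, z.xM, z.xC, z.xU, z.pc, z.b, z.χ)

/-- The usual (product) topology on the finite-dimensional space of states. -/
instance : TopologicalSpace P.State := TopologicalSpace.induced toProd inferInstance

end State

/-- The input `ζ_j = (-ω_j, p^c_j)` of the controlled dynamics. -/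
def ζ (z : P.State) (j : G ⊕ L) : ℝ × ℝ := (-z.ω j, z.pc j)

/-- Generation `p^M_j`. -/
def pM (z : P.State) (j : G) : ℝ := (P.sysM j).g (z.xM j, P.ζ z (Sum.inl j))

/-- Controllable demand `d^c_j`. -/
def dc (z : P.State) (j : G ⊕ L) : ℝ := (P.sysC j).g (z.xC j, P.ζ z j)

/-- Uncontrollable frequency dependent demand `d^u_j`. -/
def du (z : P.State) (j : G ⊕ L) : ℝ := -(P.sysU j).g (z.xU j, -z.ω j)

/-- Net supply `s_j`. -/
def supply (z : P.State) : G ⊕ L → ℝ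
  | Sum.inl j => P.pM z j - P.dc z (Sum.inl j)
  | Sum.inr j => -P.dc z (Sum.inr j)

/-- Deviation of the power transfer along a line from its nominal value. -/
def flow (z : P.State) (e : P.E) : ℝ := P.B e * Real.sin (z.η e) - P.pnom e

/-- Net power transfer into bus `j`: `- ∑_{k : j → k} p_jk + ∑_{i : i → j} p_ij`. -/
def netFlow (z : P.State) (j : G ⊕ L) : ℝ :=
  - (∑ e : P.E with e.1.1 = j, P.flow z e) + ∑ e : P.E with e.1.2 = j, P.flow z e

/-- `- ∑_{k : j → k} ψ_jk + ∑_{i : i → j} ψ_ij`. -/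
def netψ (z : P.State) (j : G ⊕ L) : ℝ :=
  - (∑ e : P.Ec with e.1.1 = j, z.ψ e) + ∑ e : P.Ec with e.1.2 = j, z.ψ e

/-- Right-hand side of the swing equation (and of the power balance at load buses). -/
def swing (z : P.State) (j : G ⊕ L) : ℝ :=
  - P.pL j + P.supply z j - P.du z j + P.netFlow z j

/-- Right-hand side of the observer copy of the swing equation. -/
def obsSwing (z : P.State) (j : G ⊕ L) : ℝ :=
  - z.χ j + P.supply z j - P.du z j + P.netFlow z j

/-- Right-hand side of the power command equation. -/
def command (z : P.State) (j : G ⊕ L) : ℝ :=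
  - (P.supply z j - z.χ j) + P.netψ z j

/-- Right-hand side of the equation for `χ_j`, `j ∈ G`. -/
def obsχ (z : P.State) (j : G) : ℝ :=
  z.b j - z.ω (Sum.inl j) - z.pc (Sum.inl j) - z.χ (Sum.inl j)

/-- Power balance at the load buses. -/
def LoadBalance (z : P.State) : Prop := ∀ j : L, P.swing z (Sum.inr j) = 0

/-- The algebraic equations of the system: power balance and observer at the load buses. -/
def Consistent (z : P.State) : Prop :=
  P.LoadBalance z ∧ ∀ j : L, P.obsSwing z (Sum.inr j) = 0

/-- `z` solves the network equations with the observer-based power command on the time set `I`. -/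
structure IsSolutionOn (z : ℝ → P.State) (I : Set ℝ) : Prop where
  cont : ContinuousOn z I
  η : ∀ t ∈ I, ∀ e : P.E, HasDerivWithinAt (fun r => (z r).η e)
    ((z t).ω e.1.1 - (z t).ω e.1.2) I t
  ω : ∀ t ∈ I, ∀ j : G, HasDerivWithinAt (fun r => P.M j * (z r).ω (Sum.inl j))
    (P.swing (z t) (Sum.inl j)) I t
  xM : ∀ t ∈ I, ∀ j : G, HasDerivWithinAt (fun r => (z r).xM j)
    ((P.sysM j).f ((z t).xM j, P.ζ (z t) (Sum.inl j))) I t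
  xC : ∀ t ∈ I, ∀ j : G ⊕ L, HasDerivWithinAt (fun r => (z r).xC j)
    ((P.sysC j).f ((z t).xC j, P.ζ (z t) j)) I t
  xU : ∀ t ∈ I, ∀ j : G ⊕ L, HasDerivWithinAt (fun r => (z r).xU j)
    ((P.sysU j).f ((z t).xU j, -(z t).ω j)) I t
  ψ : ∀ t ∈ I, ∀ e : P.Ec, HasDerivWithinAt (fun r => P.γc e * (z r).ψ e)
    ((z t).pc e.1.1 - (z t).pc e.1.2) I t
  pc : ∀ t ∈ I, ∀ j : G ⊕ L, HasDerivWithinAt (fun r => P.γ j * (z r).pc j)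
    (P.command (z t) j) I t
  χ : ∀ t ∈ I, ∀ j : G, HasDerivWithinAt (fun r => P.τ j * (z r).χ (Sum.inl j))
    (P.obsχ (z t) j) I t
  b : ∀ t ∈ I, ∀ j : G, HasDerivWithinAt (fun r => P.M j * (z r).b j)
    (P.obsSwing (z t) (Sum.inl j)) I t
  alg : ∀ t ∈ I, P.Consistent (z t)

/-- Equilibria: all time derivatives vanish (and the algebraic equations hold). -/
structure IsEquilibrium (z : P.State) : Prop where
  η : ∀ e : P.E, z.ω e.1.1 - z.ω e.1.2 = 0
  ω : ∀ j : G, P.swing z (Sum.inl j) = 0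
  xM : ∀ j : G, (P.sysM j).f (z.xM j, P.ζ z (Sum.inl j)) = 0
  xC : ∀ j : G ⊕ L, (P.sysC j).f (z.xC j, P.ζ z j) = 0
  xU : ∀ j : G ⊕ L, (P.sysU j).f (z.xU j, -z.ω j) = 0
  ψ : ∀ e : P.Ec, z.pc e.1.1 - z.pc e.1.2 = 0
  pc : ∀ j : G ⊕ L, P.command z j = 0
  χ : ∀ j : G, P.obsχ z j = 0
  b : ∀ j : G, P.obsSwing z (Sum.inl j) = 0
  alg : P.Consistent z

/-- The variables `(η, ω^G, x^c, x^u, p^c)` that determine the frequency at load buses. -/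
def algInput (z : P.State) : (P.E → ℝ) × (G → ℝ) × (∀ j : G ⊕ L, (P.sysC j).X) ×
    (∀ j : G ⊕ L, (P.sysU j).X) × (G ⊕ L → ℝ) :=
  (z.η, fun j => z.ω (Sum.inl j), z.xC, z.xU, z.pc)

/-- The load bus frequencies `ω^L`. -/
def ωL (z : P.State) : L → ℝ := fun j => z.ω (Sum.inr j)

/-- Near `zs` the power balance at the load buses determines `ω^L` as a locally Lipschitz function
of `(η, ω^G, x^c, x^u, p^c)`. -/
def LoadFrequencyRegular (zs : P.State) : Prop :=
  ∃ (T : Set ((P.E → ℝ) × (G → ℝ) × (∀ j : G ⊕ L, (P.sysC j).X) ×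
      (∀ j : G ⊕ L, (P.sysU j).X) × (G ⊕ L → ℝ))) (O : Set (L → ℝ))
    (fL : (P.E → ℝ) × (G → ℝ) × (∀ j : G ⊕ L, (P.sysC j).X) ×
      (∀ j : G ⊕ L, (P.sysU j).X) × (G ⊕ L → ℝ) → (L → ℝ)),
    IsOpen T ∧ P.algInput zs ∈ T ∧ IsOpen O ∧ P.ωL zs ∈ O ∧ LocallyLipschitzOn T fL ∧
    ∀ z : P.State, P.algInput z ∈ T → P.ωL z ∈ O →
      (P.LoadBalance z ↔ P.ωL z = fL (P.algInput z))

/-- The supply rate at bus `j`, as a function of the input `ζ` and the output `y = (s_j, -d^u_j)`,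
about the equilibrium `zs`. -/
def supplyRate (zs : P.State) (φ : ℝ × ℝ → ℝ) (j : G ⊕ L) (ζ y : ℝ × ℝ) : ℝ :=
  (y.1 - P.supply zs j) * ((ζ - P.ζ zs j).1 + (ζ - P.ζ zs j).2)
    + (y.2 - (-P.du zs j)) * (ζ - P.ζ zs j).1 - φ (ζ - P.ζ zs j)

/-- The dissipativity condition at bus `j`: the system with input `ζ_j = (-ω_j, p^c_j)`, state
`(x^M, x^c, x^u)` at a bus with inertia and `(x^c, x^u)` at a load bus, and output
`(s_j, -d^u_j)`. -/
def BusDissipative (zs : P.State) (φ : ℝ × ℝ → ℝ) : G ⊕ L → Prop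
  | Sum.inl j => LocallyDissipative
      (X := (P.sysM j).X × (P.sysC (Sum.inl j)).X × (P.sysU (Sum.inl j)).X)
      (fun q => ((P.sysM j).f (q.1.1, q.2), (P.sysC (Sum.inl j)).f (q.1.2.1, q.2),
        (P.sysU (Sum.inl j)).f (q.1.2.2, q.2.1)))
      (fun q => ((P.sysM j).g (q.1.1, q.2) - (P.sysC (Sum.inl j)).g (q.1.2.1, q.2),
        (P.sysU (Sum.inl j)).g (q.1.2.2, q.2.1)))
      (P.ζ zs (Sum.inl j)) (zs.xM j, zs.xC (Sum.inl j), zs.xU (Sum.inl j))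
      (P.supplyRate zs φ (Sum.inl j))
  | Sum.inr j => LocallyDissipative
      (X := (P.sysC (Sum.inr j)).X × (P.sysU (Sum.inr j)).X)
      (fun q => ((P.sysC (Sum.inr j)).f (q.1.1, q.2), (P.sysU (Sum.inr j)).f (q.1.2, q.2.1)))
      (fun q => (-(P.sysC (Sum.inr j)).g (q.1.1, q.2), (P.sysU (Sum.inr j)).g (q.1.2, q.2.1)))
      (P.ζ zs (Sum.inr j)) (zs.xC (Sum.inr j), zs.xU (Sum.inr j))
      (P.supplyRate zs φ (Sum.inr j))

/-- At bus `j`, when `ω_j` and `s_j` are constant then `p^c_j` cannot be a nontrivial sinusoid. -/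
def BusNoSinusoid (zs : P.State) : G ⊕ L → Prop
  | Sum.inl j => NoSinusoid
      (X := (P.sysM j).X × (P.sysC (Sum.inl j)).X)
      (fun q => ((P.sysM j).f (q.1.1, q.2), (P.sysC (Sum.inl j)).f (q.1.2, q.2)))
      (fun q => (P.sysM j).g (q.1.1, q.2) - (P.sysC (Sum.inl j)).g (q.1.2, q.2))
      (P.ζ zs (Sum.inl j)) (zs.xM j, zs.xC (Sum.inl j))
  | Sum.inr j => NoSinusoid
      (X := (P.sysC (Sum.inr j)).X)
      (fun q => (P.sysC (Sum.inr j)).f (q.1, q.2))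
      (fun q => -(P.sysC (Sum.inr j)).g (q.1, q.2))
      (P.ζ zs (Sum.inr j)) (zs.xC (Sum.inr j))

end PowerNetwork

/-- The data of the optimal supply and load control problem: costs and bounds. -/
structure OSLC (G L : Type) [Fintype G] [Fintype L] where
  C : G → ℝ → ℝ
  Cd : G ⊕ L → ℝ → ℝ
  pmin : G → ℝ
  pmax : G → ℝ
  dmin : G ⊕ L → ℝ
  dmax : G ⊕ L → ℝ
  p_le : ∀ j, pmin j ≤ pmax j
  d_le : ∀ j, dmin j ≤ dmax j

namespace OSLC

variable {G L : Type} [Fintype G] [Fintype L] (Q : OSLC G L)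

/-- The total cost. -/
def cost (p : G → ℝ) (d : G ⊕ L → ℝ) : ℝ := ∑ j, Q.C j (p j) + ∑ j, Q.Cd j (d j)

/-- Feasibility for the demand `pL`. -/
def Feasible (pL : G ⊕ L → ℝ) (p : G → ℝ) (d : G ⊕ L → ℝ) : Prop :=
  ∑ j, p j = ∑ j, (d j + pL j) ∧
  (∀ j, Q.pmin j ≤ p j ∧ p j ≤ Q.pmax j) ∧ (∀ j, Q.dmin j ≤ d j ∧ d j ≤ Q.dmax j)

/-- `(p, d)` is a global minimum of the problem with demand `pL`. -/
def IsGlobalMin (pL : G ⊕ L → ℝ) (p : G → ℝ) (d : G ⊕ L → ℝ) : Prop :=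
  Q.Feasible pL p d ∧ ∀ p' d', Q.Feasible pL p' d' → Q.cost p d ≤ Q.cost p' d'

/-- `y` clipped to the interval `[lo, hi]`. -/
def clip (lo hi y : ℝ) : ℝ := max (min y hi) lo

/-- The condition on the static characteristics of generation and controllable demand:
`k_{p^M_j}(ζ) = [(C_j')⁻¹(f ζ)]` and `k_{d^c_j}(ζ) = [(C_dj')⁻¹(-f ζ)]`, clipped to the bounds,
for some surjective `f` that is strictly increasing in `p^c`. The value `y = (C_j')⁻¹(f ζ)` is
expressed by `C_j' y = f ζ`. -/
def ControlSpec [DecidableEq G] [DecidableEq L] (P : PowerNetwork G L) : Prop :=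
  ∃ f : ℝ × ℝ → ℝ, Function.Surjective f ∧ (∀ v, StrictMono fun p => f (v, p)) ∧
    (∀ j ζ, ∃ y, deriv (Q.C j) y = f ζ ∧
      (P.sysM j).ky ζ = clip (Q.pmin j) (Q.pmax j) y) ∧
    (∀ j ζ, ∃ y, deriv (Q.Cd j) y = -f ζ ∧
      (P.sysC j).ky ζ = clip (Q.dmin j) (Q.dmax j) y)

end OSLC

end

/-! Subtracting the two algebraic equations at a load bus leaves `χ_j = p^L_j`, and the regularity
assumption expresses the load frequencies through the other variables. Near `z*` the system is
therefore an ordinary differential equation for the reduced state (`lift`, `LocalReduction`), and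
only continuity of its right-hand side is used.

The Lyapunov function is the sum of the bus storage functions and `networkEnergy`: squares of the
deviations of `ω^G`, `p^c`, `ψ`, `b - ω` and `χ^G`, weighted by inertias and time constants, and the
Bregman distance of `-cos` for each line. Line and communication terms cancel by summation by parts.
The supply rates cancel the products of supply and demand with `ω` and `p^c`, and the observer terms
cancel up to a square. What remains is `V' ≤ -∑ φ_j - ∑_G (χ_j - χ_j^*)²` (`exists_lyapunov`). Since
`V` is locally positive definite, small sublevel sets trap solutions; this gives global existence
and extension.

Convergence is LaSalle's principle without uniqueness of solutions: through a limit point runs a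
complete solution, an ultrafilter limit of time translates, along which `V` is constant
(`LyapunovPair.exists_complete_solution`). On it `ω` and `χ` are at equilibrium, so `η`, `x^u` and
the supplies are constant. At buses with inertia the observer equation makes `p^c` constant. At load
buses `p^c` is a component of a bounded solution of an undamped linear network, hence a sum of
sinusoids (`isSinusoidSum_of_network`), which must be constant by positive definiteness of `φ_j` or
by the exclusion of nontrivial sinusoids. With constant inputs, `x^M` and `x^c` are complete
trajectories in a compact part of a region of attraction, hence at rest
(`eq_of_complete_solution_of_stable`). So limit points are equilibria
(`isEquilibrium_of_invariant`).

At an equilibrium `ω` and `p^c` are uniform over the connected graphs. Summing the power balances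
and using the sign of `k_{d^u}` gives `ω = 0`; the common value of `f(ζ)` is a Lagrange multiplier
certifying optimality. Strict convexity makes the optimum unique, so `p^M` and `d^c` converge even
though the state is only shown to approach a set of equilibria. -/

/-! ### Limits of solutions, Peano existence and stability for continuous vector fields -/

section ODE

variable {X : Type*} [NormedAddCommGroup X] [NormedSpace ℝ X]

/-- Pointwise limits of approximate solutions of `x' = F x` are solutions. -/
theorem hasDerivWithinAt_of_tendsto_approx {ι : Type*} {l : Filter ι} [l.NeBot]
    {F : X → X} {K : Set X} {M : ℝ} (hM : ∀ x ∈ K, ‖F x‖ ≤ M) {s : Set ℝ} (hs : s.OrdConnected)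
    {y q : ι → ℝ → X} {e : ι → ℝ} (he : Tendsto e l (𝓝 0)) {u : ℝ → X} {t : ℝ} (ht : t ∈ s)
    (hF : ContinuousWithinAt F K (u t)) (hu : ∀ r ∈ s, Tendsto (fun i => y i r) l (𝓝 (u r)))
    (hy : ∀ r ∈ s, ∀ᶠ i in l, ∀ w ∈ uIcc t r, HasDerivWithinAt (y i) (F (q i w)) s w ∧
      q i w ∈ K ∧ dist (q i w) (y i w) ≤ e i) :
    HasDerivWithinAt u (F (u t)) s t := by
  rw [hasDerivWithinAt_iff_isLittleO, Asymptotics.isLittleO_iff]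
  intro ε hε
  obtain ⟨δ, hδ, hFδ⟩ := Metric.continuousWithinAt_iff.1 hF ε hε
  have hM1 : 0 < |M| + 1 := by positivity
  -- With speed at most `M`, this radius keeps the drift of `y i` between `t` and `r` below `δ / 3`.
  -- The other two thirds pay for `q i` versus `y i` and for `y i t` versus `u t`.
  have hnear : ∀ᶠ r in 𝓝[s] t, dist r t < δ / 3 / (|M| + 1) :=
    mem_nhdsWithin_of_mem_nhds (Metric.ball_mem_nhds t (by positivity))
  filter_upwards [hnear, self_mem_nhdsWithin] with r hr hrs
  have hsub : uIcc t r ⊆ s := hs.uIcc_subset ht hrs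
  have hconv : Convex ℝ (uIcc t r) := convex_uIcc t r
  have key : ∀ᶠ i in l, ‖y i r - y i t - (r - t) • F (u t)‖ ≤ ε * ‖r - t‖ := by
    have h1 : ∀ᶠ i in l, dist (y i t) (u t) < δ / 3 :=
      (hu t ht).eventually (Metric.ball_mem_nhds _ (by positivity))
    have h2 : ∀ᶠ i in l, e i < δ / 3 := he.eventually_lt_const (by positivity)
    filter_upwards [h1, h2, hy r hrs] with i hi1 hi2 hi3
    have hq : ∀ w ∈ uIcc t r, ‖F (q i w) - F (u t)‖ ≤ ε := by
      intro w hw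
      have hb : ‖y i w - y i t‖ ≤ M * ‖w - t‖ :=
        hconv.norm_image_sub_le_of_norm_hasDerivWithin_le
          (fun v hv => (hi3 v hv).1.mono hsub) (fun v hv => hM _ (hi3 v hv).2.1)
          left_mem_uIcc hw
      have hwt : ‖w - t‖ ≤ dist r t := by
        rw [Real.norm_eq_abs, Real.dist_eq]
        exact abs_sub_left_of_mem_uIcc hw
      have hb2 : M * ‖w - t‖ < δ / 3 := by
        calc M * ‖w - t‖ ≤ (|M| + 1) * dist r t := by
              apply mul_le_mul _ hwt (norm_nonneg _) hM1.le
              linarith [le_abs_self M]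
          _ < (|M| + 1) * (δ / 3 / (|M| + 1)) := by gcongr
          _ = δ / 3 := by field_simp
      have hd : dist (q i w) (u t) < δ := by
        have h3 := (hi3 w hw).2.2
        have h4 : dist (y i w) (y i t) < δ / 3 := by
          rw [dist_eq_norm]; linarith
        have := dist_triangle4 (q i w) (y i w) (y i t) (u t)
        linarith
      have := hFδ (hi3 w hw).2.1 hd
      rw [dist_eq_norm] at this
      exact this.le
    -- Subtracting the linear motion with velocity `F (u t)` leaves a curve of speed at most `ε`;
    -- the mean value bound is uniform in `i` and survives the limit.
    have hmv := hconv.norm_image_sub_le_of_norm_hasDerivWithin_le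
      (f := fun w => y i w - w • F (u t)) (f' := fun w => F (q i w) - F (u t)) (C := ε)
      (fun v hv => by
        have := ((hi3 v hv).1.mono hsub).sub
          ((hasDerivWithinAt_id v (uIcc t r)).smul_const (F (u t)))
        simpa [Pi.sub_def] using this) hq left_mem_uIcc right_mem_uIcc
    refine le_trans (le_of_eq ?_) hmv
    congr 1
    rw [sub_smul]
    abel
  refine le_of_tendsto ?_ key
  exact (((hu r hrs).sub (hu t ht)).sub_const _).norm

/-- An ultrafilter limit of translates of solutions in a compact set is a complete solution. -/
theorem exists_complete_solution_of_ultrafilter {F : X → X} {K : Set X} (hK : IsCompact K)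
    (hF : ContinuousOn F K) {ι : Type*} (U : Ultrafilter ι) {x : ℝ → X} {a : ι → ℝ} {s : Set ℝ}
    (hs : IsOpen s)
    (hx : ∀ t ∈ s, HasDerivWithinAt x (F (x t)) s t ∧ x t ∈ K)
    (hb : ∀ α β : ℝ, ∀ᶠ i in (U : Filter ι), Icc (a i + α) (a i + β) ⊆ s) :
    ∃ y : ℝ → X, (∀ t, HasDerivAt y (F (y t)) t ∧ y t ∈ K) ∧
      ∀ t, Tendsto (fun i => x (a i + t)) U (𝓝 (y t)) := by
  have hmem : ∀ α β : ℝ, ∀ᶠ i in (U : Filter ι), ∀ w ∈ uIcc α β, a i + w ∈ s := by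
    intro α β
    filter_upwards [hb (min α β) (max α β)] with i hi w hw
    exact hi ⟨by linarith [hw.1], by linarith [hw.2]⟩
  -- An ultrafilter converges in a compact set at every time simultaneously, so no subsequence or
  -- equicontinuity argument is needed.
  have hlim : ∀ t, ∃ p ∈ K, Tendsto (fun i => x (a i + t)) U (𝓝 p) := by
    intro t
    have : ∀ᶠ i in (U : Filter ι), x (a i + t) ∈ K := by
      filter_upwards [hmem t t] with i hi
      exact (hx _ (hi t (by simp))).2
    obtain ⟨p, hp, hle⟩ := hK.ultrafilter_le_nhds' (U.map fun i => x (a i + t)) this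
    exact ⟨p, hp, hle⟩
  choose y hyK hy using hlim
  obtain ⟨M, hM⟩ := hK.exists_bound_of_continuousOn hF
  refine ⟨y, fun t => ⟨?_, hyK t⟩, hy⟩
  rw [← hasDerivWithinAt_univ]
  refine hasDerivWithinAt_of_tendsto_approx (l := (U : Filter ι)) hM ordConnected_univ
    (y := fun i w => x (a i + w)) (q := fun i w => x (a i + w)) (e := fun _ => 0)
    tendsto_const_nhds (mem_univ t) (hF _ (hyK t)) (fun r _ => hy r) ?_
  intro r _
  filter_upwards [hmem t r] with i hi w hw
  obtain ⟨h1, h2⟩ := hx _ (hi w hw)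
  refine ⟨?_, h2, by simp⟩
  rw [hasDerivWithinAt_univ]
  exact ((h1.hasDerivAt (hs.mem_nhds (hi w hw))).comp_const_add (a i) w)

/-- One-sided derivatives agree when two solutions are concatenated. -/
theorem exists_concat {F : X → X} {x y : ℝ → X} {T : ℝ} (hT : 0 ≤ T)
    (hx : ∀ t ∈ Icc (0 : ℝ) T, HasDerivWithinAt x (F (x t)) (Icc 0 T) t)
    (hy : ∀ t ∈ Ici (0 : ℝ), HasDerivWithinAt y (F (y t)) (Ici 0) t) (hxy : y 0 = x T) :
    ∃ z : ℝ → X, (∀ t ∈ Ici (0 : ℝ), HasDerivWithinAt z (F (z t)) (Ici 0) t) ∧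
      EqOn x z (Icc 0 T) ∧ ∀ t ∈ Ici T, z t = y (t - T) := by
  set z : ℝ → X := fun t => if t ≤ T then x t else y (t - T) with hz
  have e1 : EqOn x z (Icc 0 T) := fun t ht => by simp [hz, ht.2]
  have e2 : ∀ t ∈ Ici T, z t = y (t - T) := by
    intro t ht
    rcases eq_or_lt_of_le (mem_Ici.1 ht) with rfl | h
    · simp [hz, hxy]
    · simp [hz, not_le.2 h]
  have d2 : ∀ t ∈ Ici T, HasDerivWithinAt z (F (z t)) (Ici T) t := by
    intro t ht
    have h := hy (t - T) (mem_Ici.2 (sub_nonneg.2 ht))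
    have h' : HasDerivWithinAt (fun r => y (r - T)) (F (y (t - T))) (Ici T) t := by
      have hl : HasDerivWithinAt (fun r : ℝ => r - T) 1 (Ici T) t :=
        (hasDerivWithinAt_id t _).sub_const T
      have := h.scomp t hl (fun r hr => mem_Ici.2 (sub_nonneg.2 hr))
      simpa [Function.comp_def] using this
    rw [e2 t ht]
    exact h'.congr e2 (e2 t ht)
  have d1 : ∀ t ∈ Icc (0 : ℝ) T, HasDerivWithinAt z (F (z t)) (Icc 0 T) t := by
    intro t ht
    rw [← e1 ht]
    exact (hx t ht).congr (fun r hr => (e1 hr).symm) (e1 ht).symm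
  refine ⟨z, ?_, e1, e2⟩
  intro t ht
  rcases lt_trichotomy t T with h | h | h
  · refine (d1 t ⟨ht, h.le⟩).mono_of_mem_nhdsWithin ?_
    have : Iio T ∈ 𝓝 t := Iio_mem_nhds h
    filter_upwards [self_mem_nhdsWithin, mem_nhdsWithin_of_mem_nhds this] with r h1 h2
    exact ⟨h1, (mem_Iio.1 h2).le⟩
  · have := (d1 t ⟨ht, h.le⟩).union (d2 t h.ge)
    rwa [Icc_union_Ici_eq_Ici hT] at this
  · refine (d2 t h.le).mono_of_mem_nhdsWithin ?_
    exact mem_nhdsWithin_of_mem_nhds (Ici_mem_nhds h)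

/-- A solution on `[0, τ)` of an equation with bounded continuous right-hand side extends to the
closed interval. -/
theorem exists_extension_Icc [FiniteDimensional ℝ X] {F : X → X} (hF : Continuous F) {M : ℝ}
    (hM : ∀ x, ‖F x‖ ≤ M) {τ : ℝ} (hτ : 0 < τ) {x : ℝ → X}
    (hx : ∀ t ∈ Ico (0 : ℝ) τ, HasDerivWithinAt x (F (x t)) (Ico 0 τ) t) :
    ∃ y : ℝ → X, EqOn x y (Ico 0 τ) ∧
      ∀ t ∈ Icc (0 : ℝ) τ, HasDerivWithinAt y (F (y t)) (Icc 0 τ) t := by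
  -- Bounded speed makes the solution Lipschitz, so it has a continuous continuation through `τ`.
  -- The derivative at `τ` is then the limit of the derivatives from the left.
  have hlip : LipschitzOnWith (Real.toNNReal M) x (Ico 0 τ) :=
    (convex_Ico 0 τ).lipschitzOnWith_of_nnnorm_hasDerivWithin_le hx (fun t _ => by
      rw [← NNReal.coe_le_coe, coe_nnnorm]
      exact (hM _).trans (Real.le_coe_toNNReal M))
  obtain ⟨y, hy, hxy⟩ := hlip.extend_finite_dimension
  have hyc : Continuous y := hy.continuous
  have d1 : ∀ t ∈ Ico (0 : ℝ) τ, HasDerivWithinAt y (F (y t)) (Ico 0 τ) t := by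
    intro t ht
    rw [← hxy ht]
    exact (hx t ht).congr (fun r hr => (hxy hr).symm) (hxy ht).symm
  refine ⟨y, hxy, fun t ht => ?_⟩
  rcases lt_or_eq_of_le ht.2 with h | h
  · refine (d1 t ⟨ht.1, h⟩).mono_of_mem_nhdsWithin ?_
    filter_upwards [self_mem_nhdsWithin, mem_nhdsWithin_of_mem_nhds (Iio_mem_nhds h)] with r h1 h2
    exact ⟨h1.1, h2⟩
  · subst h
    have hd : ∀ r ∈ Ioo (0 : ℝ) t, HasDerivAt y (F (y r)) r := fun r hr =>
      (d1 r ⟨hr.1.le, hr.2⟩).hasDerivAt (Ico_mem_nhds hr.1 hr.2)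
    have := hasDerivWithinAt_Iic_of_tendsto_deriv (s := Ioo 0 t) (f := y) (a := t) (e := F (y t))
      (fun r hr => (hd r hr).differentiableAt.differentiableWithinAt)
      hyc.continuousWithinAt (Ioo_mem_nhdsLT hτ) (by
        have : Tendsto (fun r => F (y r)) (𝓝[<] t) (𝓝 (F (y t))) :=
          ((hF.comp hyc).tendsto t).mono_left nhdsWithin_le_nhds
        refine this.congr' ?_
        filter_upwards [Ioo_mem_nhdsLT hτ] with r hr
        exact (hd r hr).deriv.symm)
    exact this.mono (fun r hr => hr.2)

/-- **Peano's theorem**, for a bounded continuous right-hand side. -/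
theorem exists_solution_of_continuous_bounded [FiniteDimensional ℝ X] {F : X → X}
    (hF : Continuous F) {M : ℝ} (hM : ∀ x, ‖F x‖ ≤ M) (p : X) :
    ∃ x : ℝ → X, x 0 = p ∧ ∀ t ∈ Ici (0 : ℝ), HasDerivWithinAt x (F (x t)) (Ici 0) t := by
  have : CompleteSpace X := FiniteDimensional.complete ℝ X
  have : ProperSpace X := FiniteDimensional.proper_real X
  have hM0 : 0 ≤ M := (norm_nonneg _).trans (hM p)
  -- Picard iterates of the equation with delay `h`
  let step : ℝ → (ℝ → X) → ℝ → X := fun h u t => p + ∫ s in (0 : ℝ)..t, F (u (max (s - h) 0))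
  let it : ℝ → ℕ → ℝ → X := fun h k => (step h)^[k] fun _ => p
  have it_succ : ∀ h k t, it h (k + 1) t = p + ∫ s in (0 : ℝ)..t, F (it h k (max (s - h) 0)) := by
    intro h k t
    simp only [it, Function.iterate_succ_apply', step]
  have it_zero : ∀ h k, it h k 0 = p := by
    intro h k
    cases k with
    | zero => simp [it]
    | succ k => simp [it_succ]
  have it_deriv : ∀ h k, Continuous (it h k) →
      ∀ t, HasDerivAt (it h (k + 1)) (F (it h k (max (t - h) 0))) t := by
    intro h k hc t
    have hc' : Continuous fun s => F (it h k (max (s - h) 0)) := by fun_prop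
    have h1 := (hc'.integral_hasStrictDerivAt 0 t).hasDerivAt.const_add p
    exact h1.congr_of_eventuallyEq (Eventually.of_forall fun s => it_succ h k s)
  have it_cont : ∀ h k, Continuous (it h k) := by
    intro h k
    induction k with
    | zero => exact continuous_const
    | succ k ih => exact continuous_iff_continuousAt.2 fun t => (it_deriv h k ih t).continuousAt
  have it_deriv' := fun h k => it_deriv h k (it_cont h k)
  -- On `[0, (k + 1) h]` the delayed integrand sees the previous iterate only on `[0, k h]`, so each
  -- iteration fixes the curve on one more interval of length `h`.
  have it_eq : ∀ h, 0 < h → ∀ k : ℕ, ∀ t ∈ Icc (0 : ℝ) (k * h), it h (k + 1) t = it h k t := by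
    intro h hh k
    induction k with
    | zero =>
      intro t ht
      have : t = 0 := le_antisymm (by simpa using ht.2) ht.1
      rw [this, it_zero, it_zero]
    | succ k ih =>
      intro t ht
      rw [it_succ, it_succ]
      congr 1
      refine intervalIntegral.integral_congr fun s hs => ?_
      rw [uIcc_of_le ht.1] at hs
      have h2 := ht.2
      push_cast at h2
      rw [ih]
      refine ⟨le_max_right _ _, max_le ?_ (by positivity)⟩
      linarith [hs.2]
  have it_lip : ∀ h k t t', dist (it h (k + 1) t) (it h (k + 1) t') ≤ M * |t - t'| := by
    intro h k t t'
    rw [dist_eq_norm, ← Real.norm_eq_abs]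
    exact convex_univ.norm_image_sub_le_of_norm_hasDerivWithin_le
      (fun v _ => (it_deriv' h k v).hasDerivWithinAt) (fun v _ => hM _) (mem_univ _) (mem_univ _)
  let h : ℕ → ℝ := fun n => 1 / ((n : ℝ) + 1)
  have hpos : ∀ n, 0 < h n := fun n => by positivity
  -- With `h n = 1 / (n + 1)`, `(n + 1)²` iterations are stationary up to time `n + 1`. The
  -- derivative of `y n` is `F (q n)`, and there `q n` is `y n` delayed by at most `h n`, hence
  -- within `M * h n` of it.
  let y : ℕ → ℝ → X := fun n => it (h n) ((n + 1) * (n + 1) + 1)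
  let q : ℕ → ℝ → X := fun n t => it (h n) ((n + 1) * (n + 1)) (max (t - h n) 0)
  have hlim : ∀ t, ∃ z, Tendsto (fun n => y n t) (hyperfilter ℕ : Filter ℕ) (𝓝 z) := by
    intro t
    have : ∀ᶠ n in (hyperfilter ℕ : Filter ℕ), y n t ∈ Metric.closedBall p (M * |t|) := by
      refine Eventually.of_forall fun n => ?_
      have := it_lip (h n) ((n + 1) * (n + 1)) t 0
      rw [it_zero, sub_zero] at this
      exact this
    obtain ⟨z, _, hz⟩ := (isCompact_closedBall p (M * |t|)).ultrafilter_le_nhds'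
      ((hyperfilter ℕ).map fun n => y n t) this
    exact ⟨z, hz⟩
  choose x hx using hlim
  have htop : ((hyperfilter ℕ : Ultrafilter ℕ) : Filter ℕ) ≤ atTop := Nat.hyperfilter_le_atTop
  have hh0 : Tendsto h atTop (𝓝 0) := tendsto_one_div_add_atTop_nhds_zero_nat
  refine ⟨x, ?_, fun t ht => ?_⟩
  · refine tendsto_nhds_unique (hx 0) ?_
    simp only [y, it_zero]
    exact tendsto_const_nhds
  · refine hasDerivWithinAt_of_tendsto_approx (l := (hyperfilter ℕ : Filter ℕ)) (K := univ)
      (fun x _ => hM x) ordConnected_Ici (y := y) (q := q) (e := fun n => M * h n) ?_ ht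
      hF.continuousWithinAt (fun r _ => hx r) ?_
    · simpa using (hh0.const_mul M).mono_left htop
    · intro r hr
      have hn : ∀ᶠ n : ℕ in atTop, max t r ≤ n :=
        tendsto_natCast_atTop_atTop.eventually_ge_atTop _
      filter_upwards [hn.filter_mono htop] with n hn w hw
      have hw0 : 0 ≤ w := le_trans (le_min ht hr) hw.1
      have hwn : w ≤ n := hw.2.trans hn
      have hmem : max (w - h n) 0 ∈ Icc (0 : ℝ) (((n + 1) * (n + 1) : ℕ) * h n) := by
        refine ⟨le_max_right _ _, max_le ?_ (by have := hpos n; positivity)⟩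
        have : ((((n + 1) * (n + 1) : ℕ) : ℝ)) * h n = n + 1 := by
          simp only [h]; push_cast; field_simp
        rw [this]
        linarith [hpos n]
      refine ⟨(it_deriv' _ _ w).hasDerivWithinAt, mem_univ _, ?_⟩
      simp only [q, y]
      rw [← it_eq _ (hpos n) _ _ hmem]
      refine (it_lip _ _ _ _).trans ?_
      gcongr
      rw [abs_le]
      have := hpos n
      rcases le_total (w - h n) 0 with h1 | h1
      · rw [max_eq_right h1]; constructor <;> linarith
      · rw [max_eq_left h1]; constructor <;> linarith

/-- A complete trajectory in a compact part of the region of attraction of a stable equilibrium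
is constant. -/
theorem eq_of_complete_solution_of_stable {F : X → X} {xb : X}
    (hstab : LocallyAsymptoticallyStable F xb) (hF : Continuous F) {K : Set X} (hK : IsCompact K)
    (hattr : ∀ x : ℝ → X, (∀ t ∈ Ici (0 : ℝ), HasDerivWithinAt x (F (x t)) (Ici 0) t) →
      x 0 ∈ K → Tendsto x atTop (𝓝 xb))
    {y : ℝ → X} (hy : ∀ t, HasDerivAt y (F (y t)) t) (hyK : ∀ t, y t ∈ K) (t : ℝ) : y t = xb := by
  -- A limit of `y` shifted into the remote past again starts in `K`, so it comes `δ`-close to `xb`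
  -- at some time `T`. Hence `y` itself was `δ`-close before time `t`, and Lyapunov stability keeps
  -- it `ε`-close at `t`.
  obtain ⟨w, hw, hlim⟩ := exists_complete_solution_of_ultrafilter hK hF.continuousOn
    (hyperfilter ℕ) (x := y) (a := fun n => -(n : ℝ)) (s := univ) isOpen_univ
    (fun t _ => ⟨(hy t).hasDerivWithinAt, hyK t⟩) (fun _ _ => Eventually.of_forall fun _ => subset_univ _)
  have hwlim := hattr w (fun t _ => (hw t).1.hasDerivWithinAt) (hw 0).2
  refine eq_of_forall_dist_le fun ε hε => ?_
  obtain ⟨δ, hδ, hst⟩ := hstab.1 ε hε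
  obtain ⟨T, hT⟩ := (hwlim.eventually (Metric.ball_mem_nhds xb hδ)).exists
  have h1 : ∀ᶠ n : ℕ in (hyperfilter ℕ : Filter ℕ), y (-(n : ℝ) + T) ∈ Metric.ball xb δ :=
    (hlim T).eventually (Metric.isOpen_ball.mem_nhds hT)
  have h2 : ∀ᶠ n : ℕ in (hyperfilter ℕ : Filter ℕ), T - t ≤ n :=
    (tendsto_natCast_atTop_atTop.eventually_ge_atTop (T - t)).filter_mono Nat.hyperfilter_le_atTop
  obtain ⟨n, hn1, hn2⟩ := (h1.and h2).exists
  -- The extra `1` makes the horizon positive and puts time `t` inside the half-open interval.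
  have := hst (t - (-(n : ℝ) + T) + 1) (by linarith) (fun r => y (-(n : ℝ) + T + r))
    (fun r _ => ((hy _).comp_const_add _ r).hasDerivWithinAt) (by simpa using hn1)
    (t - (-(n : ℝ) + T)) ⟨by linarith, by linarith⟩
  simp only [add_sub_cancel] at this
  exact this.le

theorem le_of_hasDerivWithinAt_nonpos {v : ℝ → ℝ} {a b : ℝ} (hab : a ≤ b)
    (hv : ContinuousOn v (Icc a b))
    (h : ∀ t ∈ Ico a b, ∃ d ≤ 0, HasDerivWithinAt v d (Ici t) t) : v b ≤ v a := by
  choose! d hd hd' using h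
  exact image_le_of_deriv_right_le_deriv_boundary hv hd' (B := fun _ => v a) (B' := fun _ => 0)
    le_rfl continuousOn_const (fun x _ => hasDerivWithinAt_const ..) hd (right_mem_Icc.2 hab)

omit [NormedSpace ℝ X] in
/-- Curves along which `V` does not increase while they are in a ball, and which start below the
values of `V` on the sphere, stay in the ball. -/
theorem mem_sublevel_of_nonincreasing {V : X → ℝ} {x₀ : X} {r c : ℝ}
    (hc : ∀ x ∈ Metric.sphere x₀ r, c ≤ V x) {x : ℝ → X} {T : ℝ}
    (hx : ContinuousOn x (Icc 0 T)) (h0 : x 0 ∈ Metric.ball x₀ r) (hV0 : V (x 0) < c)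
    (hmono : ∀ t₁ ∈ Icc 0 T, (∀ t ∈ Ico 0 t₁, x t ∈ Metric.ball x₀ r) →
      x t₁ ∈ Metric.closedBall x₀ r → V (x t₁) ≤ V (x 0)) :
    ∀ t ∈ Icc 0 T, x t ∈ Metric.ball x₀ r ∧ V (x t) < c := by
  have hin : ∀ t ∈ Icc 0 T, x t ∈ Metric.ball x₀ r := by
    by_contra! hcon
    obtain ⟨t, ht, hxt⟩ := hcon
    have hcl : IsClosed {t ∈ Icc (0 : ℝ) T | r ≤ dist (x t) x₀} := by
      have := ((continuous_id.dist continuous_const).comp_continuousOn hx).preimage_isClosed_of_isClosed isClosed_Icc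
        (isClosed_Ici (a := r)) (f := fun t => dist (x t) x₀)
      exact this
    have hcomp : IsCompact {t ∈ Icc (0 : ℝ) T | r ≤ dist (x t) x₀} :=
      isCompact_Icc.of_isClosed_subset hcl (fun t ht => ht.1)
    -- At the first exit time the curve lies exactly on the sphere, where `V` is at least `c`,
    -- although `V` has not increased from a value below `c`.
    obtain ⟨t₁, ⟨ht₁, hr₁⟩, hleast⟩ := hcomp.exists_isLeast ⟨t, ht, by simpa using hxt⟩
    have hlt : ∀ s ∈ Ico 0 t₁, x s ∈ Metric.ball x₀ r := by
      intro s hs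
      by_contra h
      have := hleast ⟨⟨hs.1, hs.2.le.trans ht₁.2⟩, by simpa using h⟩
      linarith [hs.2]
    have ht₁0 : 0 < t₁ := by
      rcases eq_or_lt_of_le ht₁.1 with h | h
      · rw [← h] at hr₁
        exact absurd h0 (by simpa using hr₁)
      · exact h
    have hle : dist (x t₁) x₀ ≤ r := by
      have hcw : ContinuousWithinAt (fun t => dist (x t) x₀) (Ico 0 t₁) t₁ :=
        (((continuous_id.dist continuous_const).comp_continuousOn hx) t₁ ht₁).mono
          (fun s hs => ⟨hs.1, hs.2.le.trans ht₁.2⟩)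
      have : (𝓝[Ico 0 t₁] t₁).NeBot := by
        rw [nhdsWithin_Ico_eq_nhdsLT ht₁0]; infer_instance
      refine le_of_tendsto hcw ?_
      filter_upwards [self_mem_nhdsWithin] with s hs
      exact (Metric.mem_ball.1 (hlt s hs)).le
    have h1 := hmono t₁ ht₁ hlt hle
    have h2 := hc (x t₁) (le_antisymm hle hr₁)
    linarith
  intro t ht
  refine ⟨hin t ht, ?_⟩
  have := hmono t ht (fun s hs => hin s ⟨hs.1, hs.2.le.trans ht.2⟩)
    (Metric.ball_subset_closedBall (hin t ht))
  linarith

/-- Radial projection onto a closed ball. -/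
noncomputable def ballProj (x₀ : X) (r : ℝ) (x : X) : X := x₀ + (r / max r ‖x - x₀‖) • (x - x₀)

theorem continuous_ballProj (x₀ : X) {r : ℝ} (hr : 0 < r) : Continuous (ballProj x₀ r) := by
  unfold ballProj
  have : ∀ x : X, max r ‖x - x₀‖ ≠ 0 := fun x => (lt_max_of_lt_left hr).ne'
  fun_prop (disch := assumption)

theorem ballProj_mem (x₀ : X) {r : ℝ} (hr : 0 < r) (x : X) :
    ballProj x₀ r x ∈ Metric.closedBall x₀ r := by
  have h : 0 < max r ‖x - x₀‖ := lt_max_of_lt_left hr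
  rw [mem_closedBall_iff_norm, ballProj, add_sub_cancel_left, norm_smul, Real.norm_eq_abs,
    abs_of_pos (by positivity), div_mul_eq_mul_div, div_le_iff₀ h]
  gcongr
  exact le_max_right _ _

theorem ballProj_eq {x₀ : X} {r : ℝ} (hr : 0 < r) {x : X} (hx : x ∈ Metric.closedBall x₀ r) :
    ballProj x₀ r x = x := by
  rw [mem_closedBall_iff_norm] at hx
  rw [ballProj, max_eq_left hx, div_self hr.ne', one_smul, add_sub_cancel]

end ODE

/-! ### Lyapunov's direct method and LaSalle's principle without uniqueness -/

/-- The setting of Lyapunov's direct method on a closed ball. -/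
structure LyapunovPair {X : Type*} [NormedAddCommGroup X] [NormedSpace ℝ X] (F : X → X)
    (V : X → ℝ) (x₀ : X) (r c : ℝ) : Prop where
  r_pos : 0 < r
  F_cont : ContinuousOn F (Metric.closedBall x₀ r)
  V_cont : ContinuousOn V (Metric.closedBall x₀ r)
  nonincreasing : ∀ (x : ℝ → X) (s : Set ℝ) (t : ℝ), x t ∈ Metric.closedBall x₀ r →
    HasDerivWithinAt x (F (x t)) s t → ∃ d ≤ 0, HasDerivWithinAt (fun τ => V (x τ)) d s t
  le_sphere : ∀ x ∈ Metric.sphere x₀ r, c ≤ V x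

namespace LyapunovPair

variable {X : Type*} [NormedAddCommGroup X] [NormedSpace ℝ X] {F : X → X} {V : X → ℝ}
  {x₀ : X} {r c : ℝ}

/-- The sublevel set of a Lyapunov function. -/
def sublevel (V : X → ℝ) (x₀ : X) (r c : ℝ) : Set X := {x | x ∈ Metric.ball x₀ r ∧ V x < c}

theorem isOpen_sublevel (h : LyapunovPair F V x₀ r c) : IsOpen (sublevel V x₀ r c) :=
  (h.V_cont.mono Metric.ball_subset_closedBall).isOpen_inter_preimage Metric.isOpen_ball isOpen_Iio

omit [NormedSpace ℝ X] in
theorem sublevel_subset : sublevel V x₀ r c ⊆ Metric.closedBall x₀ r :=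
  fun _ hx => Metric.ball_subset_closedBall hx.1

/-- A curve that solves the equation as long as it is in the ball stays in the sublevel set. -/
theorem mem_sublevel (h : LyapunovPair F V x₀ r c) {x : ℝ → X} {T : ℝ}
    (hx : ContinuousOn x (Icc 0 T)) (h0 : x 0 ∈ sublevel V x₀ r c)
    (hsol : ∀ t₁ ∈ Icc 0 T, (∀ t ∈ Ico 0 t₁, x t ∈ Metric.ball x₀ r) →
      ∀ t ∈ Ico 0 t₁, HasDerivWithinAt x (F (x t)) (Icc 0 T) t) :
    ∀ t ∈ Icc 0 T, x t ∈ sublevel V x₀ r c := by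
  refine mem_sublevel_of_nonincreasing h.le_sphere hx h0.1 h0.2 ?_
  intro t₁ ht₁ hball hcb
  have hK : ∀ t ∈ Icc 0 t₁, x t ∈ Metric.closedBall x₀ r := by
    intro t ht
    rcases lt_or_eq_of_le ht.2 with h' | h'
    · exact Metric.ball_subset_closedBall (hball t ⟨ht.1, h'⟩)
    · rwa [h']
  refine le_of_hasDerivWithinAt_nonpos (v := fun t => V (x t)) ht₁.1
    (h.V_cont.comp (hx.mono (Icc_subset_Icc_right ht₁.2)) hK) ?_
  intro t ht
  obtain ⟨d, hd, hd'⟩ := h.nonincreasing x _ t (hK t ⟨ht.1, ht.2.le⟩) (hsol t₁ ht₁ hball t ht)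
  refine ⟨d, hd, hd'.mono_of_mem_nhdsWithin ?_⟩
  filter_upwards [self_mem_nhdsWithin, mem_nhdsWithin_of_mem_nhds (Iio_mem_nhds ht.2)] with w h1 h2
  exact ⟨ht.1.trans h1, (mem_Iio.1 h2).le.trans ht₁.2⟩

variable [FiniteDimensional ℝ X]

/-- A bounded continuous vector field that agrees with `F` on the ball. -/
theorem exists_global (h : LyapunovPair F V x₀ r c) : ∃ F' : X → X, Continuous F' ∧
    (∃ M, ∀ x, ‖F' x‖ ≤ M) ∧ EqOn F' F (Metric.closedBall x₀ r) := by
  have : ProperSpace X := FiniteDimensional.proper_real X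
  obtain ⟨M, hM⟩ := (isCompact_closedBall x₀ r).exists_bound_of_continuousOn h.F_cont
  refine ⟨F ∘ ballProj x₀ r, ?_, ⟨M, fun x => hM _ (ballProj_mem x₀ h.r_pos x)⟩, ?_⟩
  · exact h.F_cont.comp_continuous (continuous_ballProj x₀ h.r_pos) (ballProj_mem x₀ h.r_pos)
  · intro x hx
    simp [ballProj_eq h.r_pos hx]

/-- Global existence for initial values in the sublevel set. -/
theorem exists_solution (h : LyapunovPair F V x₀ r c) {p : X} (hp : p ∈ sublevel V x₀ r c) :
    ∃ x : ℝ → X, x 0 = p ∧ ∀ t ∈ Ici (0 : ℝ), HasDerivWithinAt x (F (x t)) (Ici 0) t ∧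
      x t ∈ sublevel V x₀ r c := by
  obtain ⟨F', hF', ⟨M, hM⟩, heq⟩ := h.exists_global
  obtain ⟨x, hx0, hx⟩ := exists_solution_of_continuous_bounded hF' hM p
  -- The modified equation agrees with the original one inside the ball, and its solution never
  -- leaves the sublevel set, so the modification is never felt.
  have hmem : ∀ t ∈ Ici (0 : ℝ), x t ∈ sublevel V x₀ r c := by
    intro T hT
    refine h.mem_sublevel (fun t ht => (hx t ht.1).continuousWithinAt.mono Icc_subset_Ici_self)
      (hx0 ▸ hp) ?_ T ⟨hT, le_rfl⟩
    intro t₁ _ hball t ht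
    rw [← heq (Metric.ball_subset_closedBall (hball t ht))]
    exact (hx t ht.1).mono Icc_subset_Ici_self
  refine ⟨x, hx0, fun t ht => ⟨?_, hmem t ht⟩⟩
  rw [← heq (sublevel_subset (hmem t ht))]
  exact hx t ht

/-- Solutions in the sublevel set on a bounded interval extend to `[0, ∞)`. -/
theorem exists_extension (h : LyapunovPair F V x₀ r c) {τ : ℝ} (hτ : 0 < τ) {x : ℝ → X}
    (hx : ∀ t ∈ Ico (0 : ℝ) τ, HasDerivWithinAt x (F (x t)) (Ico 0 τ) t ∧
      x t ∈ sublevel V x₀ r c) :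
    ∃ y : ℝ → X, EqOn x y (Ico 0 τ) ∧ ∀ t ∈ Ici (0 : ℝ),
      HasDerivWithinAt y (F (y t)) (Ici 0) t ∧ y t ∈ sublevel V x₀ r c := by
  obtain ⟨F', hF', ⟨M, hM⟩, heq⟩ := h.exists_global
  obtain ⟨y, hxy, hy⟩ := exists_extension_Icc hF' hM hτ (x := x) (fun t ht => by
    rw [heq (sublevel_subset (hx t ht).2)]
    exact (hx t ht).1)
  have h0 : (0 : ℝ) ∈ Ico 0 τ := ⟨le_rfl, hτ⟩
  have hmem : ∀ t ∈ Icc (0 : ℝ) τ, y t ∈ sublevel V x₀ r c := by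
    refine h.mem_sublevel (fun t ht => (hy t ht).continuousWithinAt)
      (hxy h0 ▸ (hx 0 h0).2) ?_
    intro t₁ ht₁ hball t ht
    rw [← heq (Metric.ball_subset_closedBall (hball t ht))]
    exact hy t ⟨ht.1, ht.2.le.trans ht₁.2⟩
  obtain ⟨w, hw0, hw⟩ := h.exists_solution (hmem τ ⟨hτ.le, le_rfl⟩)
  obtain ⟨z, hz, hyz, hzw⟩ := exists_concat (F := F) hτ.le (fun t ht => by
    rw [← heq (sublevel_subset (hmem t ht))]
    exact hy t ht) (fun t ht => (hw t ht).1) hw0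
  refine ⟨z, fun t ht => (hxy ht).trans (hyz ⟨ht.1, ht.2.le⟩), fun t ht => ⟨hz t ht, ?_⟩⟩
  rcases le_total t τ with h' | h'
  · rw [← hyz ⟨ht, h'⟩]
    exact hmem t ⟨ht, h'⟩
  · rw [hzw t h']
    exact (hw _ (mem_Ici.2 (sub_nonneg.2 h'))).2

/-- Through every limit point of a solution there is a complete solution along which the Lyapunov
function is constant. -/
theorem exists_complete_solution (h : LyapunovPair F V x₀ r c) {x : ℝ → X}
    (hx : ∀ t ∈ Ici (0 : ℝ), HasDerivWithinAt x (F (x t)) (Ici 0) t ∧ x t ∈ sublevel V x₀ r c)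
    {p : X} (U : Ultrafilter ℝ) (hU : (U : Filter ℝ) ≤ atTop) (hp : Tendsto x U (𝓝 p)) :
    ∃ y : ℝ → X, y 0 = p ∧ (∀ t, HasDerivAt y (F (y t)) t ∧ y t ∈ Metric.closedBall x₀ r) ∧
      ∀ t, V (y t) = V (y 0) := by
  have : ProperSpace X := FiniteDimensional.proper_real X
  have hcpt := isCompact_closedBall x₀ r
  obtain ⟨y, hy, hlim⟩ := exists_complete_solution_of_ultrafilter hcpt h.F_cont U (x := x)
    (a := id) (s := Ioi 0) isOpen_Ioi
    (fun t ht => ⟨(hx t (mem_Ici.2 (le_of_lt ht))).1.mono Ioi_subset_Ici_self,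
      sublevel_subset (hx t (mem_Ici.2 (le_of_lt ht))).2⟩)
    (fun α β => by
      filter_upwards [hU (Ioi_mem_atTop (-α))] with i hi w hw
      have := hw.1
      simp only [id] at this
      exact mem_Ioi.2 (by linarith [mem_Ioi.1 hi]))
  have hanti : AntitoneOn (fun t => V (x t)) (Ici 0) := by
    intro a ha b hb hab
    refine le_of_hasDerivWithinAt_nonpos (v := fun t => V (x t)) hab (fun t ht => ?_) (fun t ht => ?_)
    · obtain ⟨d, _, hd⟩ := h.nonincreasing x _ t (sublevel_subset (hx t (ha.trans ht.1)).2)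
        (hx t (ha.trans ht.1)).1
      exact hd.continuousWithinAt.mono (fun s hs => ha.trans hs.1)
    · obtain ⟨d, hd0, hd⟩ := h.nonincreasing x _ t (sublevel_subset (hx t (ha.trans ht.1)).2)
        (hx t (ha.trans ht.1)).1
      exact ⟨d, hd0, hd.mono (fun s hs => (mem_Ici.1 ha).trans (ht.1.trans hs))⟩
  obtain ⟨m, hm⟩ := (hcpt.image_of_continuousOn h.V_cont).bddBelow
  have hlow : ∀ t ∈ Ici (0 : ℝ), m ≤ V (x t) := fun t ht =>
    hm (mem_image_of_mem V (sublevel_subset (hx t ht).2))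
  obtain ⟨v, hv⟩ : ∃ v, Tendsto (fun t => V (x t)) atTop (𝓝 v) := by
    have hanti' : Antitone fun t => V (x (max t 0)) := fun a b hab =>
      hanti (mem_Ici.2 (le_max_right _ _)) (mem_Ici.2 (le_max_right _ _)) (max_le_max_right 0 hab)
    have := tendsto_atTop_ciInf hanti' ⟨m, by
      rintro _ ⟨t, rfl⟩
      exact hlow _ (mem_Ici.2 (le_max_right _ _))⟩
    refine ⟨_, this.congr' ?_⟩
    filter_upwards [eventually_ge_atTop 0] with t ht
    rw [max_eq_left ht]
  -- For each fixed shift `t`, the values of `V` along the translates have the same limit `v` as `V`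
  -- along the solution.
  have hVy : ∀ t, V (y t) = v := by
    intro t
    have h1 : Tendsto (fun i => i + t) (U : Filter ℝ) atTop :=
      (tendsto_atTop_add_const_right _ t tendsto_id).mono_left hU
    have h2 : Tendsto (fun i => V (x (i + t))) (U : Filter ℝ) (𝓝 v) := hv.comp h1
    have h3 : Tendsto (fun i => x (i + t)) (U : Filter ℝ)
        (𝓝[Metric.closedBall x₀ r] (y t)) := by
      refine tendsto_nhdsWithin_iff.2 ⟨hlim t, ?_⟩
      filter_upwards [h1.eventually (eventually_ge_atTop 0)] with i hi
      exact sublevel_subset (hx _ hi).2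
    exact tendsto_nhds_unique ((h.V_cont _ (hy t).2).tendsto.comp h3) h2
  refine ⟨y, ?_, hy, fun t => (hVy t).trans (hVy 0).symm⟩
  have := hlim 0
  simp only [id, add_zero] at this
  exact tendsto_nhds_unique this hp

end LyapunovPair

/-! ### Bounded solutions of undamped linear networks -/

section Sinusoids

/-- Finite sums of sinusoids. -/
def IsSinusoidSum (p : ℝ → ℝ) : Prop :=
  ∃ (n : ℕ) (A ν θ : Fin n → ℝ), ∀ t, p t = ∑ k, A k * Real.sin (ν k * t + θ k)

theorem IsSinusoidSum.of_fintype {κ : Type*} [Fintype κ] {p : ℝ → ℝ} (A ν θ : κ → ℝ)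
    (h : ∀ t, p t = ∑ k, A k * Real.sin (ν k * t + θ k)) : IsSinusoidSum p := by
  refine ⟨Fintype.card κ, A ∘ (Fintype.equivFin κ).symm, ν ∘ (Fintype.equivFin κ).symm,
    θ ∘ (Fintype.equivFin κ).symm, fun t => ?_⟩
  rw [h t]
  exact ((Fintype.equivFin κ).symm.sum_comp fun k => A k * Real.sin (ν k * t + θ k)).symm

/-- Solutions of `c'' = -λ c` with `λ ≥ 0` that are bounded are harmonic oscillations. -/
theorem exists_eq_sin_of_oscillator {c d : ℝ → ℝ} {lam R : ℝ} (hlam : 0 ≤ lam)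
    (hc : ∀ t, HasDerivAt c (d t) t) (hd : ∀ t, HasDerivAt d (-(lam * c t)) t)
    (hb : ∀ t, |c t| ≤ R) :
    ∃ a b ν : ℝ, ∀ t, c t = a * Real.sin (ν * t + Real.pi / 2) + b * Real.sin (ν * t) := by
  rcases eq_or_lt_of_le hlam with h0 | hpos
  · subst h0
    have hd0 : ∀ t, d t = d 0 := fun t =>
      is_const_of_deriv_eq_zero (fun t => (hd t).differentiableAt)
        (fun t => by rw [(hd t).deriv]; ring) t 0
    have hlin : ∀ t, c t = c 0 + t * d 0 := by
      intro t
      have hder : ∀ t, HasDerivAt (fun t => c t - t * d 0) 0 t := by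
        intro t
        have := (hc t).sub ((hasDerivAt_id t).mul_const (d 0))
        rw [hd0 t, one_mul, sub_self] at this
        exact this
      have := is_const_of_deriv_eq_zero (fun t => (hder t).differentiableAt)
        (fun t => (hder t).deriv) t 0
      simp only [zero_mul, sub_zero] at this
      linarith
    -- At the time `(|c 0| + R + 1) / d 0` an affine function with slope `d 0` would exceed `R`.
    -- Boundedness is needed only in this zero-frequency case.
    have hz : d 0 = 0 := by
      by_contra hne
      have h1 := hb ((|c 0| + R + 1) / d 0)
      rw [hlin, div_mul_cancel₀ _ hne] at h1
      have h2 := (abs_le.1 h1).2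
      have h3 := neg_abs_le (c 0)
      linarith
    refine ⟨c 0, 0, 0, fun t => ?_⟩
    rw [hlin, hz]
    simp
  · set ν := Real.sqrt lam with hν
    have hνpos : 0 < ν := Real.sqrt_pos.2 hpos
    have hν2 : ν * ν = lam := Real.mul_self_sqrt hlam
    refine ⟨c 0, d 0 / ν, ν, fun t => ?_⟩
    have hl : ∀ t, HasDerivAt (fun t => ν * t) ν t := fun t => by
      simpa using (hasDerivAt_id t).const_mul ν
    -- `w` is the error against the explicit solution with the same initial data; its energy `w'² +
    -- lam w²` is conserved and vanishes at `0`.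
    set w : ℝ → ℝ := fun t => c t - (c 0 * Real.cos (ν * t) + d 0 / ν * Real.sin (ν * t)) with hw
    set w' : ℝ → ℝ := fun t => d t + c 0 * ν * Real.sin (ν * t) - d 0 * Real.cos (ν * t) with hw'
    have h1 : ∀ t, HasDerivAt w (w' t) t := by
      intro t
      have := (hc t).sub (((hl t).cos.const_mul (c 0)).add ((hl t).sin.const_mul (d 0 / ν)))
      refine this.congr_deriv ?_
      simp only [hw']
      field_simp
      ring
    have h2 : ∀ t, HasDerivAt w' (-(lam * w t)) t := by
      intro t
      have := ((hd t).add ((hl t).sin.const_mul (c 0 * ν))).sub ((hl t).cos.const_mul (d 0))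
      refine this.congr_deriv ?_
      simp only [hw, ← hν2]
      field_simp
      ring
    have h3 : ∀ t, HasDerivAt (fun t => w' t ^ 2 + lam * w t ^ 2) 0 t := by
      intro t
      have := ((h2 t).pow 2).add (((h1 t).pow 2).const_mul lam)
      refine this.congr_deriv ?_
      push_cast
      ring
    have h4 : w' t ^ 2 + lam * w t ^ 2 = 0 := by
      have := is_const_of_deriv_eq_zero (fun t => (h3 t).differentiableAt)
        (fun t => (h3 t).deriv) t 0
      rw [this]
      simp [hw, hw']
    have h5 : w t = 0 := by
      have : lam * w t ^ 2 = 0 := by nlinarith [sq_nonneg (w' t), sq_nonneg (w t)]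
      simpa [hpos.ne'] using this
    have h6 : c t = c 0 * Real.cos (ν * t) + d 0 / ν * Real.sin (ν * t) := by
      simp only [hw] at h5
      linarith
    rw [h6, Real.sin_add_pi_div_two]

/-- Bounded solutions of a linear skew-symmetric system with constant forcing. -/
theorem isSinusoidSum_inner_of_skew {E E' : Type*} [NormedAddCommGroup E] [InnerProductSpace ℝ E]
    [FiniteDimensional ℝ E] [NormedAddCommGroup E'] [InnerProductSpace ℝ E']
    [FiniteDimensional ℝ E'] (A : E →ₗ[ℝ] E') {q : ℝ → E} {u : ℝ → E'} (c : E)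
    (hq : ∀ v t, HasDerivAt (fun t => inner ℝ v (q t)) (inner ℝ v c - inner ℝ (A v) (u t)) t)
    (hu : ∀ v t, HasDerivAt (fun t => inner ℝ v (u t)) (inner ℝ v (A (q t))) t)
    (hb : ∀ v, ∃ R, ∀ t, |inner ℝ v (q t)| ≤ R) (v : E) :
    IsSinusoidSum fun t => inner ℝ v (q t) := by
  -- Differentiating once more removes the constant forcing: `q'' = -A* A q`. In an eigenbasis of
  -- the positive operator `A* A` each coordinate is a scalar oscillator.
  set T : E →ₗ[ℝ] E := LinearMap.adjoint A ∘ₗ A with hT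
  have hsym : T.IsSymmetric := (LinearMap.isPositive_adjoint_comp_self A).isSymmetric
  let b := hsym.eigenvectorBasis rfl
  have hosc : ∀ k, ∃ α β ν : ℝ, ∀ t, inner ℝ (b k) (q t) =
      α * Real.sin (ν * t + Real.pi / 2) + β * Real.sin (ν * t) := by
    intro k
    have hev : T (b k) = hsym.eigenvalues rfl k • b k := hsym.apply_eigenvectorBasis rfl k
    have hAA : ∀ x, inner ℝ (A (b k)) (A x) = hsym.eigenvalues rfl k * inner ℝ (b k) x := by
      intro x
      rw [← LinearMap.adjoint_inner_left, ← LinearMap.comp_apply, ← hT, hev, inner_smul_left]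
      rfl
    have hnn : 0 ≤ hsym.eigenvalues rfl k := by
      have h1 := hAA (b k)
      have h2 : inner ℝ (b k) (b k) = (1 : ℝ) := by
        rw [real_inner_self_eq_norm_sq, b.orthonormal.1 k, one_pow]
      rw [h2, mul_one] at h1
      rw [← h1]
      exact real_inner_self_nonneg
    obtain ⟨R, hR⟩ := hb (b k)
    refine exists_eq_sin_of_oscillator hnn (hq (b k)) (fun t => ?_) hR
    rw [← hAA]
    exact (hu (A (b k)) t).const_sub _
  choose α β ν h using hosc
  refine IsSinusoidSum.of_fintype (κ := Fin (Module.finrank ℝ E) × Bool)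
    (fun i => inner ℝ v (b i.1) * cond i.2 (α i.1) (β i.1)) (fun i => ν i.1)
    (fun i => cond i.2 (Real.pi / 2) 0) fun t => ?_
  rw [← b.sum_inner_mul_inner v (q t), Fintype.sum_prod_type]
  refine Finset.sum_congr rfl fun k _ => ?_
  rw [h k t]
  simp
  ring

/-- Summation by parts on a directed graph. -/
theorem sum_mul_net {ι κ : Type*} [Fintype ι] [Fintype κ] [DecidableEq ι] (src tgt : κ → ι)
    (a : ι → ℝ) (f : κ → ℝ) :
    ∑ j, a j * (-(∑ e with src e = j, f e) + ∑ e with tgt e = j, f e) =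
      -∑ e, f e * (a (src e) - a (tgt e)) := by
  have h : ∀ g : κ → ι, ∑ j, a j * ∑ e with g e = j, f e = ∑ e, f e * a (g e) := by
    intro g
    simp_rw [Finset.mul_sum, Finset.sum_filter]
    rw [Finset.sum_comm]
    refine Finset.sum_congr rfl fun e _ => ?_
    simp [mul_comm]
  simp_rw [mul_add, mul_neg, Finset.sum_add_distrib, Finset.sum_neg_distrib, h, mul_sub,
    Finset.sum_sub_distrib]
  ring

/-- The oscillations of the linear network `γ p' = c - Dψ`, `γ' ψ' = Dᵀ p`. -/
theorem isSinusoidSum_of_network {ι κ : Type*} [Fintype ι] [Fintype κ] [DecidableEq ι]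
    (src tgt : κ → ι) {γ : ι → ℝ} {γc : κ → ℝ} (hγ : ∀ j, 0 < γ j) (hγc : ∀ e, 0 < γc e)
    (c : ι → ℝ) {p : ℝ → ι → ℝ} {ψ : ℝ → κ → ℝ}
    (hp : ∀ t j, HasDerivAt (fun t => p t j)
      ((c j + (-(∑ e with src e = j, ψ t e) + ∑ e with tgt e = j, ψ t e)) / γ j) t)
    (hψ : ∀ t e, HasDerivAt (fun t => ψ t e) ((p t (src e) - p t (tgt e)) / γc e) t)
    {R : ℝ} (hb : ∀ t j, |p t j| ≤ R) (j : ι) : IsSinusoidSum fun t => p t j := by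
  have hs : ∀ j, 0 < √(γ j) := fun j => Real.sqrt_pos.2 (hγ j)
  have hsc : ∀ e, 0 < √(γc e) := fun e => Real.sqrt_pos.2 (hγc e)
  -- Rescaling `p` and `ψ` by the square roots of their time constants makes the two couplings
  -- negative adjoints of each other, which is the skew form required.
  let A : EuclideanSpace ℝ ι →ₗ[ℝ] EuclideanSpace ℝ κ :=
    { toFun := fun v => WithLp.toLp 2 fun e =>
        (v (src e) / √(γ (src e)) - v (tgt e) / √(γ (tgt e))) / √(γc e)
      map_add' := by
        intro v w
        ext e
        simp
        ring
      map_smul' := by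
        intro a v
        ext e
        simp
        ring }
  have hA : ∀ v e, A v e = (v (src e) / √(γ (src e)) - v (tgt e) / √(γ (tgt e))) / √(γc e) :=
    fun v e => rfl
  let q : ℝ → EuclideanSpace ℝ ι := fun t => WithLp.toLp 2 fun j => √(γ j) * p t j
  let u : ℝ → EuclideanSpace ℝ κ := fun t => WithLp.toLp 2 fun e => √(γc e) * ψ t e
  let c' : EuclideanSpace ℝ ι := WithLp.toLp 2 fun j => c j / √(γ j)
  have hin : ∀ (v w : EuclideanSpace ℝ ι), inner ℝ v w = ∑ i, v i * w i := by
    intro v w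
    simp [PiLp.inner_apply, mul_comm]
  have hin' : ∀ (v w : EuclideanSpace ℝ κ), inner ℝ v w = ∑ i, v i * w i := by
    intro v w
    simp [PiLp.inner_apply, mul_comm]
  -- Testing against the `j`-th unit vector divided by `√(γ j)` undoes the rescaling and returns `p
  -- t j`.
  have key := isSinusoidSum_inner_of_skew A (q := q) (u := u) c' ?_ ?_ ?_
    (EuclideanSpace.single j (1 / √(γ j)))
  · convert key using 2 with t
    rw [EuclideanSpace.inner_single_left]
    have := (hs j).ne'
    simp [q]
    field_simp
  · intro v t
    simp only [hin, hin']
    have h1 : ∀ j, HasDerivAt (fun t => v j * q t j) (v j * (√(γ j) *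
        ((c j + (-(∑ e with src e = j, ψ t e) + ∑ e with tgt e = j, ψ t e)) / γ j))) t :=
      fun j => ((hp t j).const_mul _).const_mul _
    refine (HasDerivAt.fun_sum fun j (_ : j ∈ Finset.univ) => h1 j).congr_deriv ?_
    have h2 := sum_mul_net src tgt (fun j => v j / √(γ j)) (ψ t)
    have h3 : ∑ e, A v e * u t e =
        ∑ e, ψ t e * (v (src e) / √(γ (src e)) - v (tgt e) / √(γ (tgt e))) := by
      refine Finset.sum_congr rfl fun e _ => ?_
      rw [hA]
      have := (hsc e).ne'
      simp only [u]
      field_simp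
    rw [h3, sub_eq_add_neg, ← h2, ← Finset.sum_add_distrib]
    refine Finset.sum_congr rfl fun j _ => ?_
    have h4 : v j * (√(γ j) * ((c j + (-(∑ e with src e = j, ψ t e) +
        ∑ e with tgt e = j, ψ t e)) / (√(γ j) * √(γ j)))) =
        v j * c' j + v j / √(γ j) * (-(∑ e with src e = j, ψ t e) + ∑ e with tgt e = j, ψ t e) := by
      have := (hs j).ne'
      simp only [c']
      field_simp
    rwa [Real.mul_self_sqrt (hγ j).le] at h4
  · intro v t
    simp only [hin']
    refine (HasDerivAt.fun_sum fun e (_ : e ∈ Finset.univ) =>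
      ((hψ t e).const_mul √(γc e)).const_mul (v e)).congr_deriv ?_
    refine Finset.sum_congr rfl fun e _ => ?_
    rw [hA]
    have h1 := (hs (src e)).ne'
    have h2 := (hs (tgt e)).ne'
    have h3 := (hsc e).ne'
    have h4 : √(γc e) * ((p t (src e) - p t (tgt e)) / (√(γc e) * √(γc e))) =
        (√(γ (src e)) * p t (src e) / √(γ (src e)) - √(γ (tgt e)) * p t (tgt e) / √(γ (tgt e)))
          / √(γc e) := by
      field_simp
    rw [Real.mul_self_sqrt (hγc e).le] at h4
    rw [h4]
  · intro v
    refine ⟨∑ j, |v j| * (√(γ j) * R), fun t => ?_⟩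
    rw [hin]
    refine (Finset.abs_sum_le_sum_abs _ _).trans (Finset.sum_le_sum fun j _ => ?_)
    simp only [q]
    rw [abs_mul, abs_mul, abs_of_pos (hs j)]
    gcongr
    exact hb t j

end Sinusoids

/-! ### Convex optimization and the line potential -/

section Convex

theorem ConvexOn.sub_mul_le_of_deriv_eq {C : ℝ → ℝ} (hC : ConvexOn ℝ univ C)
    (hd : Differentiable ℝ C) {y m : ℝ} (hy : deriv C y = m) (x : ℝ) :
    C y - m * y ≤ C x - m * x := by
  rcases lt_trichotomy y x with h | h | h
  · have := hC.le_slope_of_hasDerivAt (mem_univ y) (mem_univ x) h (hd y).hasDerivAt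
    rw [hy, slope_def_field, le_div_iff₀ (sub_pos.2 h)] at this
    linarith
  · rw [h]
  · have := hC.slope_le_of_hasDerivAt (mem_univ x) (mem_univ y) h (hd y).hasDerivAt
    rw [hy, slope_def_field, div_le_iff₀ (sub_pos.2 h)] at this
    linarith

/-- The clipped stationary point minimizes the tilted cost over the interval. -/
theorem clip_isMin {C : ℝ → ℝ} (hC : ConvexOn ℝ univ C) (hd : Differentiable ℝ C)
    {lo hi y m : ℝ} (hlh : lo ≤ hi) (hy : deriv C y = m) {x : ℝ} (hx : lo ≤ x ∧ x ≤ hi) :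
    C (OSLC.clip lo hi y) - m * OSLC.clip lo hi y ≤ C x - m * x := by
  have hg : ConvexOn ℝ univ fun x => C x - m * x := by
    have : ConcaveOn ℝ univ fun x : ℝ => m * x := by
      refine ⟨convex_univ, fun a _ b _ s t _ _ _ => le_of_eq ?_⟩
      simp only [smul_eq_mul]
      ring
    exact hC.sub this
  have hmin := ConvexOn.sub_mul_le_of_deriv_eq hC hd hy
  -- The tilted cost is convex with global minimum at `y`, so no point between `x` and `y` costs
  -- more than `x`. The clipped point always lies there when `x` is admissible.
  have hmid : ∀ z ∈ segment ℝ y x, C z - m * z ≤ C x - m * x := fun z hz =>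
    (hg.le_on_segment (mem_univ y) (mem_univ x) hz).trans (max_le (hmin x) le_rfl)
  unfold OSLC.clip
  rcases le_total y lo with h1 | h1
  · rw [min_eq_left (h1.trans hlh), max_eq_right h1]
    refine hmid lo ?_
    rw [segment_eq_Icc (h1.trans hx.1)]
    exact ⟨h1, hx.1⟩
  · rcases le_total y hi with h2 | h2
    · rw [min_eq_left h2, max_eq_left h1]
      exact hmin x
    · rw [min_eq_right h2, max_eq_left hlh]
      refine hmid hi ?_
      rw [segment_symm, segment_eq_Icc (hx.2.trans h2)]
      exact ⟨hx.2, h2⟩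

theorem clip_mem {lo hi y : ℝ} (hlh : lo ≤ hi) :
    lo ≤ OSLC.clip lo hi y ∧ OSLC.clip lo hi y ≤ hi :=
  ⟨le_max_right _ _, max_le (min_le_right _ _) hlh⟩

/-- Minimizers of a strictly convex problem are unique. -/
theorem OSLC.IsGlobalMin.unique {G L : Type} [Fintype G] [Fintype L] {Q : OSLC G L}
    (hC : ∀ j, StrictConvexOn ℝ univ (Q.C j)) (hCd : ∀ j, StrictConvexOn ℝ univ (Q.Cd j))
    {pL : G ⊕ L → ℝ} {p p' : G → ℝ} {d d' : G ⊕ L → ℝ}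
    (h : Q.IsGlobalMin pL p d) (h' : Q.IsGlobalMin pL p' d') : p = p' ∧ d = d' := by
  -- The constraints are convex, so the midpoint of two minimizers is feasible; a coordinate in
  -- which they differ would make it strictly cheaper.
  have hmid : Q.Feasible pL (fun j => (1 / 2 : ℝ) • p j + (1 / 2 : ℝ) • p' j)
      (fun j => (1 / 2 : ℝ) • d j + (1 / 2 : ℝ) • d' j) := by
    obtain ⟨⟨h1, h2, h3⟩, -⟩ := h
    obtain ⟨⟨h1', h2', h3'⟩, -⟩ := h'
    simp only [smul_eq_mul]
    refine ⟨?_, fun j => ?_, fun j => ?_⟩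
    · simp only [Finset.sum_add_distrib, ← Finset.mul_sum] at *
      linarith
    · constructor <;> linarith [h2 j, h2' j]
    · constructor <;> linarith [h3 j, h3' j]
  have heq : Q.cost p d = Q.cost p' d' := le_antisymm (h.2 _ _ h'.1) (h'.2 _ _ h.1)
  have hle := h.2 _ _ hmid
  have hconv : ∀ {f : ℝ → ℝ}, StrictConvexOn ℝ univ f → ∀ a b,
      f ((1 / 2 : ℝ) • a + (1 / 2 : ℝ) • b) ≤ 1 / 2 * f a + 1 / 2 * f b := fun hf a b =>
    hf.convexOn.2 (mem_univ a) (mem_univ b) (by norm_num) (by norm_num) (by norm_num)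
  have hstrict : ∀ {f : ℝ → ℝ}, StrictConvexOn ℝ univ f → ∀ a b, a ≠ b →
      f ((1 / 2 : ℝ) • a + (1 / 2 : ℝ) • b) < 1 / 2 * f a + 1 / 2 * f b := fun hf a b hab =>
    hf.2 (mem_univ a) (mem_univ b) hab (by norm_num) (by norm_num) (by norm_num)
  have e1 := Finset.sum_le_sum fun j (_ : j ∈ Finset.univ) => hconv (hC j) (p j) (p' j)
  have e2 := Finset.sum_le_sum fun j (_ : j ∈ Finset.univ) => hconv (hCd j) (d j) (d' j)
  simp only [OSLC.cost, Finset.sum_add_distrib, ← Finset.mul_sum] at heq hle e1 e2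
  constructor
  · by_contra hne
    obtain ⟨j, hj⟩ := Function.ne_iff.1 hne
    have := Finset.sum_lt_sum (fun j (_ : j ∈ Finset.univ) => hconv (hC j) (p j) (p' j))
      ⟨j, Finset.mem_univ j, hstrict (hC j) _ _ hj⟩
    simp only [Finset.sum_add_distrib, ← Finset.mul_sum] at this
    linarith
  · by_contra hne
    obtain ⟨j, hj⟩ := Function.ne_iff.1 hne
    have := Finset.sum_lt_sum (fun j (_ : j ∈ Finset.univ) => hconv (hCd j) (d j) (d' j))
      ⟨j, Finset.mem_univ j, hstrict (hCd j) _ _ hj⟩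
    simp only [Finset.sum_add_distrib, ← Finset.mul_sum] at this
    linarith

/-- The Bregman distance of `-cos` at a point of `(-π/2, π/2)` is locally positive definite. -/
theorem eventually_cos_bregman_pos {a : ℝ} (ha : |a| < Real.pi / 2) :
    ∀ᶠ x in 𝓝 a, 0 ≤ Real.cos a - Real.cos x - Real.sin a * (x - a) ∧
      (Real.cos a - Real.cos x - Real.sin a * (x - a) = 0 → x = a) := by
  have haI : a ∈ Ioo (-(Real.pi / 2)) (Real.pi / 2) := abs_lt.1 ha
  filter_upwards [Ioo_mem_nhds haI.1 haI.2] with x hx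
  have hconv : StrictConvexOn ℝ (Icc (-(Real.pi / 2)) (Real.pi / 2)) fun x => -Real.cos x :=
    strictConcaveOn_cos_Icc.neg
  have hder : HasDerivAt (fun x => -Real.cos x) (Real.sin a) a := by
    have := (Real.hasDerivAt_cos a).neg
    rw [neg_neg] at this
    exact this
  have hpos : x ≠ a → 0 < Real.cos a - Real.cos x - Real.sin a * (x - a) := by
    intro hne
    have hxI := Ioo_subset_Icc_self hx
    have haI' := Ioo_subset_Icc_self haI
    rcases lt_or_gt_of_ne hne with h | h
    · have := hconv.slope_lt_of_hasDerivAt hxI haI' h hder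
      rw [slope_def_field, div_lt_iff₀ (sub_pos.2 h)] at this
      linarith
    · have := hconv.lt_slope_of_hasDerivAt haI' hxI h hder
      rw [slope_def_field, lt_div_iff₀ (sub_pos.2 h)] at this
      linarith
  refine ⟨?_, fun h0 => ?_⟩
  · by_cases h : x = a
    · simp [h]
    · exact (hpos h).le
  · by_contra h
    exact (hpos h).ne' h0

end Convex

/-! ### The network equations in terms of the differential variables -/

theorem hasDerivWithinAt_prod_iff {E F : Type*} [NormedAddCommGroup E] [NormedSpace ℝ E]
    [NormedAddCommGroup F] [NormedSpace ℝ F] {f : ℝ → E × F} {f' : E × F} {s : Set ℝ} {t : ℝ} :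
    HasDerivWithinAt f f' s t ↔ HasDerivWithinAt (fun r => (f r).1) f'.1 s t ∧
      HasDerivWithinAt (fun r => (f r).2) f'.2 s t :=
  ⟨fun h => ⟨(hasFDerivAt_fst (𝕜 := ℝ) (p := f t)).comp_hasDerivWithinAt t h,
    (hasFDerivAt_snd (𝕜 := ℝ) (p := f t)).comp_hasDerivWithinAt t h⟩,
    fun h => h.1.prodMk h.2⟩

theorem hasDerivWithinAt_const_mul_iff {a : ℝ} (ha : a ≠ 0) {f : ℝ → ℝ} {f' : ℝ} {s : Set ℝ}
    {t : ℝ} : HasDerivWithinAt (fun r => a * f r) f' s t ↔ HasDerivWithinAt f (f' / a) s t := by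
  constructor
  · intro h
    have := h.div_const a
    simpa [mul_div_cancel_left₀ _ ha] using this
  · intro h
    have := h.const_mul a
    rwa [mul_div_cancel₀ _ ha] at this

namespace PowerNetwork

variable {G L : Type} [Fintype G] [Fintype L] [DecidableEq G] [DecidableEq L]
variable (P : PowerNetwork G L)

/-- The space of the variables that are governed by differential equations. -/
abbrev Reduced : Type :=
  (P.E → ℝ) × (P.Ec → ℝ) × (G → ℝ) × (∀ j : G, (P.sysM j).X) × (∀ j : G ⊕ L, (P.sysC j).X) ×
    (∀ j : G ⊕ L, (P.sysU j).X) × (G ⊕ L → ℝ) × (G → ℝ) × (G → ℝ)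

/-- The variables that are governed by differential equations. -/
def reduce (z : P.State) : P.Reduced :=
  (z.η, z.ψ, fun j => z.ω (Sum.inl j), z.xM, z.xC, z.xU, z.pc, z.b, fun j => z.χ (Sum.inl j))

/-- The right-hand sides of the differential equations. -/
noncomputable def field (z : P.State) : P.Reduced :=
  (fun e => z.ω e.1.1 - z.ω e.1.2, fun e => (z.pc e.1.1 - z.pc e.1.2) / P.γc e,
    fun j => P.swing z (Sum.inl j) / P.M j,
    fun j => (P.sysM j).f (z.xM j, P.ζ z (Sum.inl j)),
    fun j => (P.sysC j).f (z.xC j, P.ζ z j),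
    fun j => (P.sysU j).f (z.xU j, -z.ω j),
    fun j => P.command z j / P.γ j, fun j => P.obsSwing z (Sum.inl j) / P.M j,
    fun j => P.obsχ z j / P.τ j)

/-- The curve `z` satisfies the differential equations at time `t`. -/
def SolvesAt (z : ℝ → P.State) (s : Set ℝ) (t : ℝ) : Prop :=
  HasDerivWithinAt (fun r => P.reduce (z r)) (P.field (z t)) s t

variable {P}

theorem solvesAt_iff {z : ℝ → P.State} {s : Set ℝ} {t : ℝ} : P.SolvesAt z s t ↔
    (∀ e, HasDerivWithinAt (fun r => (z r).η e) ((z t).ω e.1.1 - (z t).ω e.1.2) s t) ∧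
    (∀ e, HasDerivWithinAt (fun r => (z r).ψ e)
      (((z t).pc e.1.1 - (z t).pc e.1.2) / P.γc e) s t) ∧
    (∀ j, HasDerivWithinAt (fun r => (z r).ω (Sum.inl j)) (P.swing (z t) (Sum.inl j) / P.M j) s t) ∧
    (∀ j, HasDerivWithinAt (fun r => (z r).xM j)
      ((P.sysM j).f ((z t).xM j, P.ζ (z t) (Sum.inl j))) s t) ∧
    (∀ j, HasDerivWithinAt (fun r => (z r).xC j) ((P.sysC j).f ((z t).xC j, P.ζ (z t) j)) s t) ∧
    (∀ j, HasDerivWithinAt (fun r => (z r).xU j) ((P.sysU j).f ((z t).xU j, -(z t).ω j)) s t) ∧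
    (∀ j, HasDerivWithinAt (fun r => (z r).pc j) (P.command (z t) j / P.γ j) s t) ∧
    (∀ j, HasDerivWithinAt (fun r => (z r).b j) (P.obsSwing (z t) (Sum.inl j) / P.M j) s t) ∧
    (∀ j, HasDerivWithinAt (fun r => (z r).χ (Sum.inl j)) (P.obsχ (z t) j / P.τ j) s t) := by
  simp only [SolvesAt, hasDerivWithinAt_prod_iff, hasDerivWithinAt_pi, reduce, field]

/-- The positive inertias and time constants can be divided out. Continuity stays a separate clause
because the load entries of `ω` and `χ` have no differential equation. -/
theorem isSolutionOn_iff {z : ℝ → P.State} {I : Set ℝ} : P.IsSolutionOn z I ↔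
    ContinuousOn z I ∧ ∀ t ∈ I, P.SolvesAt z I t ∧ P.Consistent (z t) := by
  constructor
  · intro h
    refine ⟨h.cont, fun t ht => ⟨solvesAt_iff.2 ⟨h.η t ht, fun e => ?_, fun j => ?_, h.xM t ht,
      h.xC t ht, h.xU t ht, fun j => ?_, fun j => ?_, fun j => ?_⟩, h.alg t ht⟩⟩
    · exact (hasDerivWithinAt_const_mul_iff (P.γc_pos e).ne').1 (h.ψ t ht e)
    · exact (hasDerivWithinAt_const_mul_iff (P.M_pos j).ne').1 (h.ω t ht j)
    · exact (hasDerivWithinAt_const_mul_iff (P.γ_pos j).ne').1 (h.pc t ht j)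
    · exact (hasDerivWithinAt_const_mul_iff (P.M_pos j).ne').1 (h.b t ht j)
    · exact (hasDerivWithinAt_const_mul_iff (P.τ_pos j).ne').1 (h.χ t ht j)
  · rintro ⟨hc, h⟩
    have h' := fun t ht => solvesAt_iff.1 (h t ht).1
    exact
      { cont := hc
        η := fun t ht => (h' t ht).1
        ψ := fun t ht e => (hasDerivWithinAt_const_mul_iff (P.γc_pos e).ne').2 ((h' t ht).2.1 e)
        ω := fun t ht j => (hasDerivWithinAt_const_mul_iff (P.M_pos j).ne').2 ((h' t ht).2.2.1 j)
        xM := fun t ht => (h' t ht).2.2.2.1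
        xC := fun t ht => (h' t ht).2.2.2.2.1
        xU := fun t ht => (h' t ht).2.2.2.2.2.1
        pc := fun t ht j =>
          (hasDerivWithinAt_const_mul_iff (P.γ_pos j).ne').2 ((h' t ht).2.2.2.2.2.2.1 j)
        b := fun t ht j =>
          (hasDerivWithinAt_const_mul_iff (P.M_pos j).ne').2 ((h' t ht).2.2.2.2.2.2.2.1 j)
        χ := fun t ht j =>
          (hasDerivWithinAt_const_mul_iff (P.τ_pos j).ne').2 ((h' t ht).2.2.2.2.2.2.2.2 j)
        alg := fun t ht => (h t ht).2 }

/-! ### Continuity of the state components, outputs and vector field -/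

section Continuity

theorem continuous_toProd : Continuous (State.toProd : P.State → _) := continuous_induced_dom

theorem continuous_η : Continuous fun z : P.State => z.η :=
  continuous_fst.comp continuous_toProd

theorem continuous_ψ : Continuous fun z : P.State => z.ψ :=
  (continuous_fst.comp continuous_snd).comp continuous_toProd

theorem continuous_ω : Continuous fun z : P.State => z.ω :=
  ((continuous_fst.comp continuous_snd).comp continuous_snd).comp continuous_toProd

theorem continuous_xM : Continuous fun z : P.State => z.xM :=
  (((continuous_fst.comp continuous_snd).comp continuous_snd).comp continuous_snd).comp
    continuous_toProd

theorem continuous_xC : Continuous fun z : P.State => z.xC :=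
  ((((continuous_fst.comp continuous_snd).comp continuous_snd).comp continuous_snd).comp
    continuous_snd).comp continuous_toProd

theorem continuous_xU : Continuous fun z : P.State => z.xU :=
  (((((continuous_fst.comp continuous_snd).comp continuous_snd).comp continuous_snd).comp
    continuous_snd).comp continuous_snd).comp continuous_toProd

theorem continuous_pc : Continuous fun z : P.State => z.pc :=
  ((((((continuous_fst.comp continuous_snd).comp continuous_snd).comp continuous_snd).comp
    continuous_snd).comp continuous_snd).comp continuous_snd).comp continuous_toProd

theorem continuous_b : Continuous fun z : P.State => z.b :=
  (((((((continuous_fst.comp continuous_snd).comp continuous_snd).comp continuous_snd).comp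
    continuous_snd).comp continuous_snd).comp continuous_snd).comp continuous_snd).comp
    continuous_toProd

theorem continuous_χ : Continuous fun z : P.State => z.χ :=
  (((((((continuous_snd.comp continuous_snd).comp continuous_snd).comp continuous_snd).comp
    continuous_snd).comp continuous_snd).comp continuous_snd).comp continuous_snd).comp
    continuous_toProd

attribute [fun_prop] continuous_η continuous_ψ continuous_ω continuous_xM continuous_xC
  continuous_xU continuous_pc continuous_b continuous_χ

@[fun_prop]
theorem continuous_reduce : Continuous (P.reduce) := by
  unfold reduce
  fun_prop

theorem continuous_ζ (j : G ⊕ L) : Continuous fun z => P.ζ z j := by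
  unfold ζ
  fun_prop

theorem continuous_pM : Continuous P.pM :=
  continuous_pi fun j => (P.sysM j).g_cont.comp
    (((continuous_apply j).comp continuous_xM).prodMk (continuous_ζ _))

theorem continuous_dc : Continuous P.dc :=
  continuous_pi fun j => (P.sysC j).g_cont.comp
    (((continuous_apply j).comp continuous_xC).prodMk (continuous_ζ _))

theorem continuous_du : Continuous P.du :=
  continuous_pi fun j => ((P.sysU j).g_cont.comp
    (((continuous_apply j).comp continuous_xU).prodMk
      ((continuous_apply j).comp continuous_ω).neg)).neg

theorem continuous_supply : Continuous P.supply := by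
  refine continuous_pi fun j => ?_
  have h1 := fun j => (continuous_apply j).comp (continuous_pM (P := P))
  have h2 := fun j => (continuous_apply j).comp (continuous_dc (P := P))
  cases j with
  | inl j => exact (h1 j).sub (h2 _)
  | inr j => exact (h2 _).neg

theorem continuous_netFlow : Continuous P.netFlow := by
  unfold netFlow flow
  fun_prop

theorem continuous_netψ : Continuous P.netψ := by
  unfold netψ
  fun_prop

attribute [fun_prop] continuous_ζ continuous_pM continuous_dc continuous_du continuous_supply
  continuous_netFlow continuous_netψ

theorem continuous_field : Continuous P.field := by
  have hM : ∀ j, Continuous (P.sysM j).f := fun j => (P.sysM j).f_lip.continuous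
  have hC : ∀ j, Continuous (P.sysC j).f := fun j => (P.sysC j).f_lip.continuous
  have hU : ∀ j, Continuous (P.sysU j).f := fun j => (P.sysU j).f_lip.continuous
  have hs : Continuous P.swing := by unfold swing; fun_prop
  have ho : Continuous P.obsSwing := by unfold obsSwing; fun_prop
  have hc : Continuous P.command := by unfold command; fun_prop
  have hχ : Continuous P.obsχ := by unfold obsχ; fun_prop
  unfold field
  fun_prop

theorem continuousOn_state {α : Type*} [TopologicalSpace α] {f : α → P.State} {s : Set α}
    (h1 : ContinuousOn (fun a => P.reduce (f a)) s) (h2 : ContinuousOn (fun a => P.ωL (f a)) s)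
    (h3 : ContinuousOn (fun a => fun j : L => (f a).χ (Sum.inr j)) s) : ContinuousOn f s := by
  have hind : IsInducing (State.toProd : P.State → _) := ⟨rfl⟩
  rw [hind.continuousOn_iff]
  have hω : ContinuousOn (fun a => (f a).ω) s := by
    refine continuousOn_pi.2 fun j => ?_
    cases j with
    | inl j => exact ((continuous_apply j).comp
        ((continuous_fst.comp continuous_snd).comp continuous_snd)).comp_continuousOn h1
    | inr j => exact (continuous_apply j).comp_continuousOn h2
  have hχ : ContinuousOn (fun a => (f a).χ) s := by
    refine continuousOn_pi.2 fun j => ?_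
    cases j with
    | inl j => exact ((continuous_apply j).comp
        (((((((continuous_snd.comp continuous_snd).comp continuous_snd).comp continuous_snd).comp
        continuous_snd).comp continuous_snd).comp continuous_snd).comp
        continuous_snd)).comp_continuousOn h1
    | inr j => exact (continuous_apply j).comp_continuousOn h3
  have h4 := h1.snd
  have h5 := h4.snd.snd
  have h6 := h5.snd
  have h7 := h6.snd
  have h8 := h7.snd
  exact h1.fst.prodMk (h4.fst.prodMk (hω.prodMk (h5.fst.prodMk (h6.fst.prodMk (h7.fst.prodMk
    (h8.fst.prodMk (h8.snd.fst.prodMk hχ)))))))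

end Continuity

/-! ### Equilibria: nominal frequency and optimality -/

/-- The two algebraic equations at a load bus differ only in `p^L` versus `χ`. Hence `χ` is a known
constant there and can be eliminated. -/
theorem consistent_iff {z : P.State} :
    P.Consistent z ↔ P.LoadBalance z ∧ ∀ j : L, z.χ (Sum.inr j) = P.pL (Sum.inr j) := by
  unfold Consistent LoadBalance swing obsSwing
  refine and_congr_right fun h => forall_congr' fun j => ?_
  have := h j
  constructor <;> intro h' <;> linarith

/-- Induction along a walk; the orientation of the edges is irrelevant because equality is
symmetric. It serves for `ω` on the power lines and for `p^c` on the communication lines. -/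
theorem const_of_connected {α β : Type*} {R : α → α → Prop} (hc : (SimpleGraph.fromRel R).Connected)
    {f : α → β} (h : ∀ i j, R i j → f i = f j) (i j : α) : f i = f j := by
  obtain ⟨w⟩ := hc.preconnected i j
  induction w with
  | nil => rfl
  | cons hadj _ ih =>
    rw [SimpleGraph.fromRel_adj] at hadj
    rcases hadj.2 with h' | h'
    · exact (h _ _ h').trans ih
    · exact (h _ _ h').symm.trans ih

namespace IsEquilibrium

variable {z : P.State} (hz : P.IsEquilibrium z)
include hz

theorem ω_eq (i j : G ⊕ L) : z.ω i = z.ω j :=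
  const_of_connected P.E_connected
    (fun i j (h : (i, j) ∈ P.E) => sub_eq_zero.1 (hz.η ⟨(i, j), h⟩)) i j

theorem pc_eq (i j : G ⊕ L) : z.pc i = z.pc j :=
  const_of_connected P.Ec_connected
    (fun i j (h : (i, j) ∈ P.Ec) => sub_eq_zero.1 (hz.ψ ⟨(i, j), h⟩)) i j

theorem swing_eq_zero (j : G ⊕ L) : P.swing z j = 0 := by
  cases j with
  | inl j => exact hz.ω j
  | inr j => exact hz.alg.1 j

theorem obsSwing_eq_zero (j : G ⊕ L) : P.obsSwing z j = 0 := by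
  cases j with
  | inl j => exact hz.b j
  | inr j => exact hz.alg.2 j

theorem χ_eq (j : G ⊕ L) : z.χ j = P.pL j := by
  have h1 := hz.swing_eq_zero j
  have h2 := hz.obsSwing_eq_zero j
  unfold swing at h1
  unfold obsSwing at h2
  linarith

end IsEquilibrium

/-- What a line takes from one end it delivers to the other. -/
theorem sum_netFlow (z : P.State) : ∑ j, P.netFlow z j = 0 := by
  have := sum_mul_net (fun e : P.E => e.1.1) (fun e => e.1.2) (fun _ => 1) (P.flow z)
  simpa [netFlow] using this

theorem sum_netψ (z : P.State) : ∑ j, P.netψ z j = 0 := by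
  have := sum_mul_net (fun e : P.Ec => e.1.1) (fun e => e.1.2) (fun _ => 1) z.ψ
  simpa [netψ] using this

namespace IsEquilibrium

variable {z : P.State} (hz : P.IsEquilibrium z)
include hz

/-- In the sum of the power command equations the `ψ` terms cancel, and `χ = p^L` at equilibrium. -/
theorem sum_supply : ∑ j, P.supply z j = ∑ j, P.pL j := by
  have h : ∑ j, P.command z j = 0 := Finset.sum_eq_zero fun j _ => hz.pc j
  simp only [command, Finset.sum_add_distrib, Finset.sum_neg_distrib, Finset.sum_sub_distrib,
    sum_netψ, hz.χ_eq] at h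
  linarith

theorem xM_eq (j : G) : z.xM j = (P.sysM j).kx (P.ζ z (Sum.inl j)) :=
  (P.sysM j).kx_unique _ _ (hz.xM j)

theorem xC_eq (j : G ⊕ L) : z.xC j = (P.sysC j).kx (P.ζ z j) :=
  (P.sysC j).kx_unique _ _ (hz.xC j)

theorem xU_eq (j : G ⊕ L) : z.xU j = (P.sysU j).kx (-z.ω j) :=
  (P.sysU j).kx_unique _ _ (hz.xU j)

/-- At equilibrium the frequency is nominal. -/
theorem ω_eq_zero (hdu : ∀ j, ∀ u : ℝ, u ≠ 0 → 0 < u * (P.sysU j).ky u) (j : G ⊕ L) :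
    z.ω j = 0 := by
  by_contra hne
  have h : ∑ j, P.swing z j = 0 := Finset.sum_eq_zero fun j _ => hz.swing_eq_zero j
  simp only [swing, Finset.sum_add_distrib, Finset.sum_neg_distrib, Finset.sum_sub_distrib,
    sum_netFlow, hz.sum_supply] at h
  -- Supply matches `p^L` in total and the line flows cancel, so the uncontrollable demands sum to
  -- zero. At a common nonzero frequency they would all have the same strict sign.
  have hdu0 : ∑ j, P.du z j = 0 := by linarith
  have hpos : 0 < ∑ i, -z.ω j * (P.sysU i).ky (-z.ω j) :=
    Finset.sum_pos (fun i _ => hdu i _ (neg_ne_zero.2 hne)) ⟨j, Finset.mem_univ j⟩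
  have : ∀ i, P.du z i = -(P.sysU i).ky (-z.ω j) := by
    intro i
    simp only [du, IOSystem.ky, hz.xU_eq i, hz.ω_eq i j]
  simp only [this, Finset.sum_neg_distrib] at hdu0
  rw [← Finset.mul_sum] at hpos
  have h0 : ∑ i, (P.sysU i).ky (-z.ω j) = 0 := by linarith
  rw [h0, mul_zero] at hpos
  exact lt_irrefl _ hpos

/-- Equilibria solve the optimal supply and load control problem. -/
theorem isGlobalMin {Q : OSLC G L}
    (hC : ∀ j, ContDiff ℝ 1 (Q.C j) ∧ StrictConvexOn ℝ univ (Q.C j))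
    (hCd : ∀ j, ContDiff ℝ 1 (Q.Cd j) ∧ StrictConvexOn ℝ univ (Q.Cd j))
    (hspec : Q.ControlSpec P) : Q.IsGlobalMin P.pL (P.pM z) (P.dc z) := by
  obtain ⟨f, -, -, hfM, hfC⟩ := hspec
  have hζ : ∀ i j, P.ζ z i = P.ζ z j := fun i j => by
    simp only [ζ, hz.ω_eq i j, hz.pc_eq i j]
  have hpM : ∀ j, P.pM z j = (P.sysM j).ky (P.ζ z (Sum.inl j)) := fun j => by
    simp only [pM, IOSystem.ky, hz.xM_eq j]
  have hdc : ∀ j, P.dc z j = (P.sysC j).ky (P.ζ z j) := fun j => by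
    simp only [dc, IOSystem.ky, hz.xC_eq j]
  obtain ⟨j₀⟩ := P.E_connected.nonempty
  -- The input `ζ` is the same at every bus, so `m` is a single multiplier for the power balance
  -- constraint.
  set m := f (P.ζ z j₀) with hm
  have hp : ∀ j, ∃ y, deriv (Q.C j) y = m ∧ P.pM z j = OSLC.clip (Q.pmin j) (Q.pmax j) y := by
    intro j
    obtain ⟨y, h1, h2⟩ := hfM j (P.ζ z (Sum.inl j))
    exact ⟨y, by rw [h1, hζ _ j₀], (hpM j).trans h2⟩
  have hd : ∀ j, ∃ y, deriv (Q.Cd j) y = -m ∧ P.dc z j = OSLC.clip (Q.dmin j) (Q.dmax j) y := by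
    intro j
    obtain ⟨y, h1, h2⟩ := hfC j (P.ζ z j)
    exact ⟨y, by rw [h1, hζ _ j₀], (hdc j).trans h2⟩
  have hbal : ∑ j, P.pM z j = ∑ j, (P.dc z j + P.pL j) := by
    have h := hz.sum_supply
    simp only [Fintype.sum_sum_type, supply, Finset.sum_sub_distrib, Finset.sum_neg_distrib] at h
    simp only [Fintype.sum_sum_type, Finset.sum_add_distrib]
    linarith
  refine ⟨⟨hbal, fun j => ?_, fun j => ?_⟩, ?_⟩
  · obtain ⟨y, -, h⟩ := hp j
    rw [h]
    exact clip_mem (Q.p_le j)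
  · obtain ⟨y, -, h⟩ := hd j
    rw [h]
    exact clip_mem (Q.d_le j)
  · rintro p' d' ⟨hbal', hp', hd'⟩
    -- Each device minimizes its own term of the Lagrangian, with price `m` for generation and `-m`
    -- for demand. By the balance constraint the price terms reduce to the same constant for both
    -- candidates.
    have e1 : ∑ j, (Q.C j (P.pM z j) - m * P.pM z j) ≤ ∑ j, (Q.C j (p' j) - m * p' j) := by
      refine Finset.sum_le_sum fun j _ => ?_
      obtain ⟨y, h1, h2⟩ := hp j
      rw [h2]
      exact clip_isMin (hC j).2.convexOn ((hC j).1.differentiable one_ne_zero) (Q.p_le j) h1 (hp' j)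
    have e2 : ∑ j, (Q.Cd j (P.dc z j) - -m * P.dc z j) ≤ ∑ j, (Q.Cd j (d' j) - -m * d' j) := by
      refine Finset.sum_le_sum fun j _ => ?_
      obtain ⟨y, h1, h2⟩ := hd j
      rw [h2]
      exact clip_isMin (hCd j).2.convexOn ((hCd j).1.differentiable one_ne_zero) (Q.d_le j) h1
        (hd' j)
    simp only [Finset.sum_sub_distrib, ← Finset.mul_sum, Finset.sum_add_distrib] at e1 e2 hbal hbal'
    unfold OSLC.cost
    rw [hbal] at e1
    rw [hbal'] at e1
    linarith

end IsEquilibrium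

end PowerNetwork

/-! ### The Lyapunov function and its dissipation -/

/-- Derivative of a storage function along a curve. -/
theorem LocallyDissipative.exists_storage {X U Y : Type*} [NormedAddCommGroup X] [NormedSpace ℝ X]
    [TopologicalSpace U] {f : X × U → X} {g : X × U → Y} {ub : U} {xb : X} {W : U → Y → ℝ}
    (h : LocallyDissipative f g ub xb W) :
    ∃ V : X → ℝ, Continuous V ∧ V xb = 0 ∧ (∀ᶠ x in 𝓝 xb, 0 ≤ V x ∧ (V x = 0 → x = xb)) ∧
      ∀ᶠ p in 𝓝 (xb, ub), ∀ (x : ℝ → X) (s : Set ℝ) (t : ℝ), x t = p.1 →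
        HasDerivWithinAt x (f p) s t →
        ∃ d ≤ W p.2 (g p), HasDerivWithinAt (fun r => V (x r)) d s t := by
  obtain ⟨V, A, B, hV, hA, hub, hB, hxb, hV0, hpos, hdiss⟩ := h
  refine ⟨V, hV.continuous, hV0, ?_, ?_⟩
  · rw [eventually_nhdsWithin_iff] at hpos
    filter_upwards [hpos] with x hx
    by_cases hxx : x = xb
    · simp [hxx, hV0]
    · exact ⟨(hx hxx).le, fun h0 => absurd h0 (hx hxx).ne'⟩
  · filter_upwards [(hB.prod hA).mem_nhds ⟨hxb, hub⟩] with p hp x s t hx hd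
    refine ⟨_, hdiss p.2 hp.2 p.1 hp.1, ?_⟩
    have := (hV.differentiable one_ne_zero p.1).hasFDerivAt
    rw [← hx] at this
    have := this.comp_hasDerivWithinAt t hd
    rw [hx] at this
    exact this

namespace PowerNetwork

variable {G L : Type} [Fintype G] [Fintype L] [DecidableEq G] [DecidableEq L]
variable {P : PowerNetwork G L}

/-- The storage function of a bus, as a function of the state of the network. -/
theorem BusDissipative.exists_storage {zs : P.State} {φ : ℝ × ℝ → ℝ} {j : G ⊕ L}
    (h : P.BusDissipative zs φ j) :
    ∃ W : P.State → ℝ, Continuous W ∧ W zs = 0 ∧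
      (∀ᶠ z in 𝓝 zs, 0 ≤ W z ∧ (W z = 0 → (∀ i, j = Sum.inl i → z.xM i = zs.xM i) ∧
        z.xC j = zs.xC j ∧ z.xU j = zs.xU j)) ∧
      ∀ᶠ z₀ in 𝓝 zs, ∀ (z : ℝ → P.State) (s : Set ℝ) (t : ℝ), z t = z₀ → P.SolvesAt z s t →
        ∃ d ≤ P.supplyRate zs φ j (P.ζ z₀ j) (P.supply z₀ j, -P.du z₀ j),
          HasDerivWithinAt (fun r => W (z r)) d s t := by
  cases j with
  | inl j =>
    rw [BusDissipative] at h
    obtain ⟨V, hV, hV0, hpos, hdiss⟩ := h.exists_storage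
    have hc : Continuous fun z : P.State => (z.xM j, z.xC (Sum.inl j), z.xU (Sum.inl j)) := by
      fun_prop
    have hc' : Continuous fun z : P.State =>
        ((z.xM j, z.xC (Sum.inl j), z.xU (Sum.inl j)), P.ζ z (Sum.inl j)) := by fun_prop
    refine ⟨_, hV.comp hc, hV0, ?_, ?_⟩
    · filter_upwards [hc.continuousAt.eventually hpos] with z hz
      refine ⟨hz.1, fun h0 => ?_⟩
      have := hz.2 h0
      simp only [Prod.mk.injEq] at this
      refine ⟨fun i hi => ?_, this.2⟩
      obtain rfl := Sum.inl_injective hi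
      exact this.1
    · filter_upwards [hc'.continuousAt.eventually hdiss] with z₀ h₀ z s t hz hsol
      subst hz
      obtain ⟨-, -, -, hM, hC, hU, -⟩ := solvesAt_iff.1 hsol
      obtain ⟨d, hd, hd'⟩ := h₀ (fun r => ((z r).xM j, (z r).xC (Sum.inl j), (z r).xU (Sum.inl j)))
        s t rfl ((hM j).prodMk ((hC _).prodMk (hU _)))
      refine ⟨d, hd.trans_eq ?_, hd'⟩
      simp [du, supply, pM, dc, ζ]
  | inr j =>
    rw [BusDissipative] at h
    obtain ⟨V, hV, hV0, hpos, hdiss⟩ := h.exists_storage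
    have hc : Continuous fun z : P.State => (z.xC (Sum.inr j), z.xU (Sum.inr j)) := by
      fun_prop
    have hc' : Continuous fun z : P.State =>
        ((z.xC (Sum.inr j), z.xU (Sum.inr j)), P.ζ z (Sum.inr j)) := by fun_prop
    refine ⟨_, hV.comp hc, hV0, ?_, ?_⟩
    · filter_upwards [hc.continuousAt.eventually hpos] with z hz
      refine ⟨hz.1, fun h0 => ?_⟩
      have := hz.2 h0
      simp only [Prod.mk.injEq] at this
      exact ⟨fun i hi => (Sum.inr_ne_inl hi).elim, this⟩
    · filter_upwards [hc'.continuousAt.eventually hdiss] with z₀ h₀ z s t hz hsol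
      subst hz
      obtain ⟨-, -, -, -, hC, hU, -⟩ := solvesAt_iff.1 hsol
      obtain ⟨d, hd, hd'⟩ := h₀ (fun r => ((z r).xC (Sum.inr j), (z r).xU (Sum.inr j)))
        s t rfl ((hC _).prodMk (hU _))
      refine ⟨d, hd.trans_eq ?_, hd'⟩
      simp [du, supply, dc, ζ]

/-- The part of the Lyapunov function that belongs to the network and the power command. -/
noncomputable def networkEnergy (zs z : P.State) : ℝ :=
  ∑ j : G, P.M j / 2 * (z.ω (Sum.inl j) - zs.ω (Sum.inl j)) ^ 2 +
  ∑ j, P.γ j / 2 * (z.pc j - zs.pc j) ^ 2 +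
  ∑ e, P.γc e / 2 * (z.ψ e - zs.ψ e) ^ 2 +
  ∑ e, P.B e * (Real.cos (zs.η e) - Real.cos (z.η e) - Real.sin (zs.η e) * (z.η e - zs.η e)) +
  ∑ j : G, P.M j / 2 * ((z.b j - z.ω (Sum.inl j)) - (zs.b j - zs.ω (Sum.inl j))) ^ 2 +
  ∑ j : G, P.τ j / 2 * (z.χ (Sum.inl j) - zs.χ (Sum.inl j)) ^ 2

theorem continuous_networkEnergy (zs : P.State) : Continuous (networkEnergy zs) := by
  unfold networkEnergy
  fun_prop

/-- All terms are weighted squares except those of the lines, which are positive only locally, by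
strict convexity of `-cos` around `η*`. The value of `b` is recovered from `b - ω` and `ω`. -/
theorem eventually_networkEnergy_pos {zs : P.State} (hη : ∀ e, |zs.η e| < Real.pi / 2) :
    ∀ᶠ z in 𝓝 zs, 0 ≤ networkEnergy zs z ∧ (networkEnergy zs z = 0 →
      z.η = zs.η ∧ z.ψ = zs.ψ ∧ (∀ j : G, z.ω (Sum.inl j) = zs.ω (Sum.inl j)) ∧ z.pc = zs.pc ∧
      z.b = zs.b ∧ ∀ j : G, z.χ (Sum.inl j) = zs.χ (Sum.inl j)) := by
  have hc : ∀ e, Continuous fun z : P.State => z.η e := fun e => by fun_prop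
  have := eventually_all.2 fun e => (hc e).continuousAt.eventually (eventually_cos_bregman_pos (hη e))
  filter_upwards [this] with z hz
  have p1 : ∀ j ∈ (Finset.univ : Finset G),
      0 ≤ P.M j / 2 * (z.ω (Sum.inl j) - zs.ω (Sum.inl j)) ^ 2 :=
    fun j _ => by have := P.M_pos j; positivity
  have p2 : ∀ j ∈ (Finset.univ : Finset (G ⊕ L)), 0 ≤ P.γ j / 2 * (z.pc j - zs.pc j) ^ 2 :=
    fun j _ => by have := P.γ_pos j; positivity
  have p3 : ∀ e ∈ (Finset.univ : Finset P.Ec), 0 ≤ P.γc e / 2 * (z.ψ e - zs.ψ e) ^ 2 :=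
    fun e _ => by have := P.γc_pos e; positivity
  have p4 : ∀ e ∈ (Finset.univ : Finset P.E), 0 ≤ P.B e *
      (Real.cos (zs.η e) - Real.cos (z.η e) - Real.sin (zs.η e) * (z.η e - zs.η e)) :=
    fun e _ => mul_nonneg (P.B_pos e).le (hz e).1
  have p5 : ∀ j ∈ (Finset.univ : Finset G), 0 ≤ P.M j / 2 *
      ((z.b j - z.ω (Sum.inl j)) - (zs.b j - zs.ω (Sum.inl j))) ^ 2 :=
    fun j _ => by have := P.M_pos j; positivity
  have p6 : ∀ j ∈ (Finset.univ : Finset G),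
      0 ≤ P.τ j / 2 * (z.χ (Sum.inl j) - zs.χ (Sum.inl j)) ^ 2 :=
    fun j _ => by have := P.τ_pos j; positivity
  have s1 := Finset.sum_nonneg p1
  have s2 := Finset.sum_nonneg p2
  have s3 := Finset.sum_nonneg p3
  have s4 := Finset.sum_nonneg p4
  have s5 := Finset.sum_nonneg p5
  have s6 := Finset.sum_nonneg p6
  unfold networkEnergy
  refine ⟨by positivity, fun h0 => ?_⟩
  have z1 := (Finset.sum_eq_zero_iff_of_nonneg p1).1 (by linarith)
  have z2 := (Finset.sum_eq_zero_iff_of_nonneg p2).1 (by linarith)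
  have z3 := (Finset.sum_eq_zero_iff_of_nonneg p3).1 (by linarith)
  have z4 := (Finset.sum_eq_zero_iff_of_nonneg p4).1 (by linarith)
  have z5 := (Finset.sum_eq_zero_iff_of_nonneg p5).1 (by linarith)
  have z6 := (Finset.sum_eq_zero_iff_of_nonneg p6).1 (by linarith)
  have sq : ∀ {a x y : ℝ}, 0 < a → a / 2 * (x - y) ^ 2 = 0 → x = y := by
    intro a x y ha h
    have : (x - y) ^ 2 = 0 := (mul_eq_zero.1 h).resolve_left (by positivity)
    exact sub_eq_zero.1 (pow_eq_zero_iff two_ne_zero |>.1 this)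
  have hω : ∀ j : G, z.ω (Sum.inl j) = zs.ω (Sum.inl j) :=
    fun j => sq (P.M_pos j) (z1 j (Finset.mem_univ j))
  refine ⟨funext fun e => ?_, funext fun e => sq (P.γc_pos e) (z3 e (Finset.mem_univ e)), hω,
    funext fun j => sq (P.γ_pos j) (z2 j (Finset.mem_univ j)), funext fun j => ?_,
    fun j => sq (P.τ_pos j) (z6 j (Finset.mem_univ j))⟩
  · exact (hz e).2 ((mul_eq_zero.1 (z4 e (Finset.mem_univ e))).resolve_left (P.B_pos e).ne')
  · have := sq (P.M_pos j) (z5 j (Finset.mem_univ j))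
    linarith [hω j]

/-- The derivative of the energy of the network along solutions. -/
theorem hasDerivWithinAt_networkEnergy {zs : P.State} {z : ℝ → P.State} {s : Set ℝ} {t : ℝ}
    (h : P.SolvesAt z s t) : HasDerivWithinAt (fun r => networkEnergy zs (z r))
      (∑ j : G, ((z t).ω (Sum.inl j) - zs.ω (Sum.inl j)) * P.swing (z t) (Sum.inl j) +
      ∑ j, ((z t).pc j - zs.pc j) * P.command (z t) j +
      ∑ e : P.Ec, ((z t).ψ e - zs.ψ e) * ((z t).pc e.1.1 - (z t).pc e.1.2) +
      ∑ e : P.E, P.B e * ((Real.sin ((z t).η e) - Real.sin (zs.η e)) *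
        ((z t).ω e.1.1 - (z t).ω e.1.2)) +
      ∑ j : G, (((z t).b j - (z t).ω (Sum.inl j)) - (zs.b j - zs.ω (Sum.inl j))) *
        (P.obsSwing (z t) (Sum.inl j) - P.swing (z t) (Sum.inl j)) +
      ∑ j : G, ((z t).χ (Sum.inl j) - zs.χ (Sum.inl j)) * P.obsχ (z t) j) s t := by
  obtain ⟨hη, hψ, hω, -, -, -, hpc, hb, hχ⟩ := solvesAt_iff.1 h
  have quad : ∀ {a c v : ℝ} {f : ℝ → ℝ}, 0 < a → HasDerivWithinAt f (v / a) s t →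
      HasDerivWithinAt (fun r => a / 2 * (f r - c) ^ 2) ((f t - c) * v) s t := by
    intro a c v f ha hf
    refine (((hf.sub_const c).pow 2).const_mul (a / 2)).congr_deriv ?_
    have := ha.ne'
    push_cast
    field_simp
  unfold networkEnergy
  refine (((((HasDerivWithinAt.fun_sum fun j _ => quad (P.M_pos j) (hω j)).add
    (HasDerivWithinAt.fun_sum fun j _ => quad (P.γ_pos j) (hpc j))).add
    (HasDerivWithinAt.fun_sum fun e _ => quad (P.γc_pos e) (hψ e))).add
    (HasDerivWithinAt.fun_sum fun e _ => ?_)).add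
    (HasDerivWithinAt.fun_sum fun j _ => quad (P.M_pos j) ?_)).add
    (HasDerivWithinAt.fun_sum fun j _ => quad (P.τ_pos j) (hχ j))
  · refine ((((hη e).cos.const_sub _).sub (((hη e).sub_const _).const_mul _)).const_mul
      (P.B e)).congr_deriv ?_
    ring
  · refine ((hb j).sub (hω j)).congr_deriv ?_
    ring

/-- The Lyapunov function of the network. -/
theorem exists_lyapunov {zs : P.State} (hzs : P.IsEquilibrium zs)
    (hη : ∀ e, |zs.η e| < Real.pi / 2) {φ : G ⊕ L → ℝ × ℝ → ℝ}
    (hdiss : ∀ j, P.BusDissipative zs (φ j) j) :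
    ∃ V : P.State → ℝ, Continuous V ∧
      (∀ᶠ z in 𝓝 zs, 0 ≤ V z ∧ (V z = 0 → P.reduce z = P.reduce zs)) ∧ V zs = 0 ∧
      ∀ᶠ z₀ in 𝓝 zs, P.Consistent z₀ → ∀ (z : ℝ → P.State) (s : Set ℝ) (t : ℝ), z t = z₀ →
        P.SolvesAt z s t → ∃ d ≤ -(∑ j, φ j (P.ζ z₀ j - P.ζ zs j) +
          ∑ j : G, (z₀.χ (Sum.inl j) - zs.χ (Sum.inl j)) ^ 2),
          HasDerivWithinAt (fun r => V (z r)) d s t := by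
  choose W hWc hW0 hWpos hWd using fun j => (hdiss j).exists_storage
  refine ⟨fun z => ∑ j, W j z + networkEnergy zs z, ?_, ?_, ?_, ?_⟩
  · exact (continuous_finsetSum _ fun j _ => hWc j).add (continuous_networkEnergy zs)
  · filter_upwards [eventually_all.2 hWpos, eventually_networkEnergy_pos hη] with z hz hn
    have hs : 0 ≤ ∑ j, W j z := Finset.sum_nonneg fun j _ => (hz j).1
    refine ⟨add_nonneg hs hn.1, fun h0 => ?_⟩
    have h1 := (Finset.sum_eq_zero_iff_of_nonneg fun j _ => (hz j).1).1
      (le_antisymm (by linarith [hn.1]) hs)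
    have hW := fun j => (hz j).2 (h1 j (Finset.mem_univ j))
    obtain ⟨e1, e2, e3, e4, e5, e6⟩ := hn.2 (by linarith [hn.1])
    simp only [reduce, Prod.mk.injEq]
    exact ⟨e1, e2, funext e3, funext fun j => (hW (Sum.inl j)).1 j rfl, funext fun j => (hW j).2.1,
      funext fun j => (hW j).2.2, e4, e5, funext e6⟩
  · simp [hW0, networkEnergy]
  · filter_upwards [eventually_all.2 hWd] with z₀ hd hcons z s t hz hsol
    subst hz
    choose d hd hd' using fun j => hd j z s t rfl hsol
    refine ⟨_, ?_, (HasDerivWithinAt.fun_sum fun j _ => hd' j).add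
      (hasDerivWithinAt_networkEnergy hsol)⟩
    set y := z t with hy
    have hφ : ∀ j, d j ≤ (P.supply y j - P.supply zs j) *
        (-(y.ω j - zs.ω j) + (y.pc j - zs.pc j)) +
        (P.du y j - P.du zs j) * (y.ω j - zs.ω j) - φ j (P.ζ y j - P.ζ zs j) := by
      intro j
      refine (hd j).trans_eq ?_
      simp only [supplyRate, ζ, Prod.fst_sub, Prod.snd_sub]
      ring
    have hsw : ∀ j, P.swing y j = (P.supply y j - P.supply zs j) - (P.du y j - P.du zs j) +
        (P.netFlow y j - P.netFlow zs j) := by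
      intro j
      have := hzs.swing_eq_zero j
      unfold swing at this ⊢
      linarith
    have hcm : ∀ j, P.command y j = -(P.supply y j - P.supply zs j) + (y.χ j - zs.χ j) +
        (P.netψ y j - P.netψ zs j) := by
      intro j
      have := hzs.pc j
      unfold command at this ⊢
      linarith
    -- Thus `b - ω` is driven by the error of `χ` alone, which is why the energy is built on `b - ω`
    -- and not on `b`.
    have hob : ∀ j, P.obsSwing y j - P.swing y j = -(y.χ j - zs.χ j) := by
      intro j
      have := hzs.χ_eq j
      unfold swing obsSwing
      linarith
    have hχ : ∀ j, P.obsχ y j = ((y.b j - y.ω (Sum.inl j)) - (zs.b j - zs.ω (Sum.inl j))) -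
        (y.pc (Sum.inl j) - zs.pc (Sum.inl j)) - (y.χ (Sum.inl j) - zs.χ (Sum.inl j)) := by
      intro j
      have := hzs.χ j
      unfold obsχ at this ⊢
      linarith
    have hload : ∀ j : L, P.swing y (Sum.inr j) = 0 ∧ y.χ (Sum.inr j) - zs.χ (Sum.inr j) = 0 := by
      intro j
      refine ⟨hcons.1 j, ?_⟩
      rw [(consistent_iff.1 hcons).2 j, hzs.χ_eq, sub_self]
    have nf : ∑ j, (y.ω j - zs.ω j) * (P.netFlow y j - P.netFlow zs j) =
        -∑ e : P.E, P.B e * ((Real.sin (y.η e) - Real.sin (zs.η e)) *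
          (y.ω e.1.1 - y.ω e.1.2)) := by
      have h1 := sum_mul_net (fun e : P.E => e.1.1) (fun e => e.1.2)
        (fun j => y.ω j - zs.ω j) (fun e => P.flow y e - P.flow zs e)
      have h2 : ∀ j, P.netFlow y j - P.netFlow zs j =
          -(∑ e : P.E with e.1.1 = j, (P.flow y e - P.flow zs e)) +
          ∑ e : P.E with e.1.2 = j, (P.flow y e - P.flow zs e) := by
        intro j
        simp only [netFlow, Finset.sum_sub_distrib]
        ring
      simp only [h2]
      rw [h1]
      congr 1
      refine Finset.sum_congr rfl fun e _ => ?_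
      have := hzs.η e
      simp only [flow]
      linear_combination (-(P.B e * (Real.sin (y.η e) - Real.sin (zs.η e)))) * this
    have nψ : ∑ j, (y.pc j - zs.pc j) * (P.netψ y j - P.netψ zs j) =
        -∑ e : P.Ec, (y.ψ e - zs.ψ e) * (y.pc e.1.1 - y.pc e.1.2) := by
      have h1 := sum_mul_net (fun e : P.Ec => e.1.1) (fun e => e.1.2)
        (fun j => y.pc j - zs.pc j) (fun e => y.ψ e - zs.ψ e)
      have h2 : ∀ j, P.netψ y j - P.netψ zs j =
          -(∑ e : P.Ec with e.1.1 = j, (y.ψ e - zs.ψ e)) +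
          ∑ e : P.Ec with e.1.2 = j, (y.ψ e - zs.ψ e) := by
        intro j
        simp only [netψ, Finset.sum_sub_distrib]
        ring
      simp only [h2]
      rw [h1]
      congr 1
      refine Finset.sum_congr rfl fun e _ => ?_
      have := hzs.ψ e
      linear_combination (-(y.ψ e - zs.ψ e)) * this
    -- The supply rate cancels the products of supply and demand errors with those of `ω` and `p^c`.
    -- The products of the `χ` error with those of `p^c` and `b - ω` cancel between the command and
    -- observer equations, leaving minus its square.
    have bG : ∑ j : G, (d (Sum.inl j) +
        (y.ω (Sum.inl j) - zs.ω (Sum.inl j)) * P.swing y (Sum.inl j) +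
        (y.pc (Sum.inl j) - zs.pc (Sum.inl j)) * P.command y (Sum.inl j) +
        ((y.b j - y.ω (Sum.inl j)) - (zs.b j - zs.ω (Sum.inl j))) *
          (P.obsSwing y (Sum.inl j) - P.swing y (Sum.inl j)) +
        (y.χ (Sum.inl j) - zs.χ (Sum.inl j)) * P.obsχ y j) ≤
        ∑ j : G, ((y.ω (Sum.inl j) - zs.ω (Sum.inl j)) *
            (P.netFlow y (Sum.inl j) - P.netFlow zs (Sum.inl j)) +
          (y.pc (Sum.inl j) - zs.pc (Sum.inl j)) *
            (P.netψ y (Sum.inl j) - P.netψ zs (Sum.inl j)) -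
          φ (Sum.inl j) (P.ζ y (Sum.inl j) - P.ζ zs (Sum.inl j)) -
          (y.χ (Sum.inl j) - zs.χ (Sum.inl j)) ^ 2) := by
      refine Finset.sum_le_sum fun j _ => ?_
      rw [hob, hcm, hχ, hsw]
      linarith [hφ (Sum.inl j)]
    have bL : ∑ j : L, (d (Sum.inr j) +
        (y.pc (Sum.inr j) - zs.pc (Sum.inr j)) * P.command y (Sum.inr j)) ≤
        ∑ j : L, ((y.ω (Sum.inr j) - zs.ω (Sum.inr j)) *
            (P.netFlow y (Sum.inr j) - P.netFlow zs (Sum.inr j)) +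
          (y.pc (Sum.inr j) - zs.pc (Sum.inr j)) *
            (P.netψ y (Sum.inr j) - P.netψ zs (Sum.inr j)) -
          φ (Sum.inr j) (P.ζ y (Sum.inr j) - P.ζ zs (Sum.inr j))) := by
      refine Finset.sum_le_sum fun j _ => ?_
      obtain ⟨h1, h2⟩ := hload j
      rw [hsw] at h1
      -- A load bus stores no kinetic energy; its power balance times the frequency error is a zero
      -- that plays the role of the missing swing term.
      have h3 : (y.ω (Sum.inr j) - zs.ω (Sum.inr j)) *
          ((P.supply y (Sum.inr j) - P.supply zs (Sum.inr j)) -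
          (P.du y (Sum.inr j) - P.du zs (Sum.inr j)) +
          (P.netFlow y (Sum.inr j) - P.netFlow zs (Sum.inr j))) = 0 := by rw [h1, mul_zero]
      rw [hcm, h2]
      linarith [hφ (Sum.inr j)]
    simp only [Fintype.sum_sum_type] at nf nψ ⊢
    simp only [Finset.sum_add_distrib, Finset.sum_sub_distrib] at bG bL nf nψ ⊢
    linarith

end PowerNetwork

/-! ### Complete solutions on which the Lyapunov function is constant -/

theorem eq_of_hasDerivAt_zero {E : Type*} [NormedAddCommGroup E] [NormedSpace ℝ E] {f : ℝ → E}
    (h : ∀ t, HasDerivAt f 0 t) (t s : ℝ) : f t = f s :=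
  is_const_of_deriv_eq_zero (fun t => (h t).differentiableAt) (fun t => (h t).deriv) t s

theorem eq_zero_of_hasDerivAt_const_of_bounded {f : ℝ → ℝ} {c R : ℝ} (h : ∀ t, HasDerivAt f c t)
    (hb : ∀ t, |f t| ≤ R) : c = 0 := by
  by_contra hne
  have hder : ∀ t, HasDerivAt (fun t => f t - t * c) 0 t := by
    intro t
    have := (h t).sub ((hasDerivAt_id t).mul_const c)
    rw [one_mul, sub_self] at this
    exact this
  have h1 := eq_of_hasDerivAt_zero hder ((|f 0| + R + 1) / c) 0
  simp only [div_mul_cancel₀ _ hne, zero_mul, sub_zero] at h1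
  have h2 := (abs_le.1 (hb ((|f 0| + R + 1) / c))).2
  have h3 := neg_abs_le (f 0)
  linarith

namespace IOSystem

variable {U : Type} [NormedAddCommGroup U]

/-- The set `K` is contained in the region of attraction of the equilibrium `kx u`. -/
def Attracts (S : IOSystem U) (u : U) (K : Set S.X) : Prop :=
  ∀ x : ℝ → S.X, (∀ t ∈ Ici (0 : ℝ), HasDerivWithinAt x (S.f (x t, u)) (Ici 0) t) →
    x 0 ∈ K → Tendsto x atTop (𝓝 (S.kx u))

/-- Local attractivity provides a radius for one fixed input. That radius may shrink as the input
varies, which `CommonBasin` rules out. -/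
theorem eventually_attracts (S : IOSystem U) (ub : U) :
    ∀ᶠ r in 𝓝 (0 : ℝ), S.Attracts ub (Metric.closedBall (S.kx ub) r) := by
  obtain ⟨δ, hδ, h⟩ := (S.kx_stable ub).2
  filter_upwards [eventually_closedBall_subset (Metric.ball_mem_nhds (S.kx ub) hδ)] with r hr
  exact fun x hx h0 => h x hx (hr h0)

theorem CommonBasin.eventually_attracts {S : IOSystem U} {ub : U} (h : S.CommonBasin ub) :
    ∀ᶠ r in 𝓝 (0 : ℝ), ∀ u, dist u ub ≤ r → S.Attracts u (Metric.closedBall (S.kx ub) r) := by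
  obtain ⟨A, hA, X₀, hX, h⟩ := h
  filter_upwards [eventually_closedBall_subset hA, eventually_closedBall_subset hX] with r h1 h2
  exact fun u hu x hx h0 => h u (h1 hu) x hx (h2 h0)

/-- Complete trajectories for a constant input in a compact part of the region of attraction are
at equilibrium. -/
theorem Attracts.eq_kx {S : IOSystem U} {u : U} {K : Set S.X} (h : S.Attracts u K)
    (hK : IsCompact K) {y : ℝ → S.X} (hy : ∀ t, HasDerivAt y (S.f (y t, u)) t)
    (hyK : ∀ t, y t ∈ K) (t : ℝ) : y t = S.kx u :=
  eq_of_complete_solution_of_stable (S.kx_stable u)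
    (S.f_lip.continuous.comp (by fun_prop : Continuous fun x => (x, u))) hK h hy hyK t

end IOSystem

theorem PosDefFun.nonneg {φ : ℝ × ℝ → ℝ} (h : PosDefFun φ) (ζ : ℝ × ℝ) : 0 ≤ φ ζ := by
  by_cases h0 : ζ = 0
  · rw [h0, h.1]
  · exact (h.2 ζ h0).le

theorem PosDefFun.eq_zero {φ : ℝ × ℝ → ℝ} (h : PosDefFun φ) {ζ : ℝ × ℝ} (h0 : φ ζ = 0) :
    ζ = 0 := by
  by_contra hne
  exact (h.2 ζ hne).ne' h0

namespace PowerNetwork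

variable {G L : Type} [Fintype G] [Fintype L] [DecidableEq G] [DecidableEq L]
variable {P : PowerNetwork G L}

/-- The radius `r` is so small that the local conditions on supply and demand hold on the closed
ball of radius `r`. -/
structure SmallRadius (zs : P.State) (φ : G ⊕ L → ℝ × ℝ → ℝ) (r : ℝ) : Prop where
  xU : ∀ j, (P.sysU j).Attracts (-zs.ω j) (Metric.closedBall (zs.xU j) r)
  xM : ∀ j u, dist u (P.ζ zs (Sum.inl j)) ≤ r →
    ((∃ i, PosDefFun (φ i)) → u = P.ζ zs (Sum.inl j)) →
    (P.sysM j).Attracts u (Metric.closedBall (zs.xM j) r)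
  xC : ∀ j u, dist u (P.ζ zs j) ≤ r → ((∃ i, PosDefFun (φ i)) → u = P.ζ zs j) →
    (P.sysC j).Attracts u (Metric.closedBall (zs.xC j) r)
  noSinusoid : ∀ j : L, PosDefFun (φ (Sum.inr j)) ∨ ∀ (s₀ : ℝ) (p : ℝ → ℝ)
    (x : ℝ → (P.sysC (Sum.inr j)).X),
    (∀ t, dist (-zs.ω (Sum.inr j), p t) (P.ζ zs (Sum.inr j)) ≤ r ∧
      dist (x t) (zs.xC (Sum.inr j)) ≤ r) →
    (∀ t, HasDerivAt x ((P.sysC (Sum.inr j)).f (x t, (-zs.ω (Sum.inr j), p t))) t) →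
    (∀ t, -(P.sysC (Sum.inr j)).g (x t, (-zs.ω (Sum.inr j), p t)) = s₀) →
    ¬ IsNontrivialSinusoid p

/-- There are finitely many buses and each condition is local. Sinusoids have to be excluded at load
buses only, since elsewhere the observer makes `p^c` constant. -/
theorem eventually_smallRadius {zs : P.State} (hzs : P.IsEquilibrium zs)
    {φ : G ⊕ L → ℝ × ℝ → ℝ}
    (hφ : ∀ j, PosDefFun (φ j) ∨ (PosDefFstFun (φ j) ∧ P.BusNoSinusoid zs j))
    (hbasin : (∃ j, PosDefFun (φ j)) ∨
      ((∀ j, (P.sysM j).CommonBasin (P.ζ zs (Sum.inl j))) ∧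
        ∀ j, (P.sysC j).CommonBasin (P.ζ zs j))) :
    ∀ᶠ r in 𝓝 (0 : ℝ), SmallRadius zs φ r := by
  -- If some `φ i` is positive definite, `p^c` will be pinned to its equilibrium value everywhere
  -- and a single input matters. Otherwise the limiting `p^c` may differ from it, and the common
  -- basin covers all nearby inputs.
  have aux : ∀ (S : IOSystem (ℝ × ℝ)) (ub : ℝ × ℝ),
      (∃ j, PosDefFun (φ j)) ∨ S.CommonBasin ub →
      ∀ᶠ r in 𝓝 (0 : ℝ), ∀ u, dist u ub ≤ r → ((∃ i, PosDefFun (φ i)) → u = ub) →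
        S.Attracts u (Metric.closedBall (S.kx ub) r) := by
    rintro S ub (h | h)
    · filter_upwards [S.eventually_attracts ub] with r hr u _ hu
      rw [hu h]
      exact hr
    · filter_upwards [h.eventually_attracts] with r hr u hu _
      exact hr u hu
  have h1 := eventually_all.2 fun j => (P.sysU j).eventually_attracts (-zs.ω j)
  have h2 := eventually_all.2 fun j => aux (P.sysM j) (P.ζ zs (Sum.inl j))
    (hbasin.imp_right fun h => h.1 j)
  have h3 := eventually_all.2 fun j => aux (P.sysC j) (P.ζ zs j) (hbasin.imp_right fun h => h.2 j)
  have h4 : ∀ j : L, ∀ᶠ r in 𝓝 (0 : ℝ), PosDefFun (φ (Sum.inr j)) ∨ ∀ (s₀ : ℝ) (p : ℝ → ℝ)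
      (x : ℝ → (P.sysC (Sum.inr j)).X),
      (∀ t, dist (-zs.ω (Sum.inr j), p t) (P.ζ zs (Sum.inr j)) ≤ r ∧
        dist (x t) (zs.xC (Sum.inr j)) ≤ r) →
      (∀ t, HasDerivAt x ((P.sysC (Sum.inr j)).f (x t, (-zs.ω (Sum.inr j), p t))) t) →
      (∀ t, -(P.sysC (Sum.inr j)).g (x t, (-zs.ω (Sum.inr j), p t)) = s₀) →
      ¬ IsNontrivialSinusoid p := by
    intro j
    rcases hφ (Sum.inr j) with h | ⟨-, h⟩
    · exact Eventually.of_forall fun r => Or.inl h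
    · rw [BusNoSinusoid] at h
      obtain ⟨A, hA, B, hB, h⟩ := h
      filter_upwards [eventually_closedBall_subset hA, eventually_closedBall_subset hB]
        with r hr1 hr2
      refine Or.inr fun s₀ p x hx hd hs => ?_
      exact h (zs.ω (Sum.inr j)) s₀ p x (fun t _ => ⟨hr1 (hx t).1, hr2 (hx t).2⟩)
        (fun t _ => (hd t).hasDerivWithinAt) (fun t _ => hs t)
  filter_upwards [h1, h2, h3, eventually_all.2 h4] with r h1 h2 h3 h4
  refine ⟨fun j => ?_, fun j => ?_, fun j => ?_, h4⟩
  · rw [hzs.xU_eq]; exact h1 j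
  · rw [hzs.xM_eq]; exact h2 j
  · rw [hzs.xC_eq]; exact h3 j

/-- Complete solutions close to the equilibrium along which the Lyapunov function is constant are
at equilibrium. -/
theorem isEquilibrium_of_invariant {zs : P.State} (hzs : P.IsEquilibrium zs)
    {φ : G ⊕ L → ℝ × ℝ → ℝ} (hφ : ∀ j, PosDefFun (φ j) ∨ PosDefFstFun (φ j)) {r : ℝ}
    (hr : SmallRadius zs φ r) {z : ℝ → P.State}
    (hsol : ∀ t, P.SolvesAt z univ t) (hcons : ∀ t, P.Consistent (z t))
    (hball : ∀ t, P.reduce (z t) ∈ Metric.closedBall (P.reduce zs) r)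
    (hφ0 : ∀ t j, φ j (P.ζ (z t) j - P.ζ zs j) = 0)
    (hχ0 : ∀ t, ∀ j : G, (z t).χ (Sum.inl j) = zs.χ (Sum.inl j)) :
    P.IsEquilibrium (z 0) := by
  have hsol' := fun t => solvesAt_iff.1 (hsol t)
  simp only [hasDerivWithinAt_univ] at hsol'
  -- the components stay in closed balls
  have hb := fun t => Metric.mem_closedBall.1 (hball t)
  simp only [reduce, Prod.dist_eq, max_le_iff] at hb
  have bψ : ∀ t e, dist ((z t).ψ e) (zs.ψ e) ≤ r := fun t e =>
    (dist_le_pi_dist _ _ e).trans (hb t).2.1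
  have bxM : ∀ t j, dist ((z t).xM j) (zs.xM j) ≤ r := fun t j =>
    (dist_le_pi_dist _ _ j).trans (hb t).2.2.2.1
  have bxC : ∀ t j, dist ((z t).xC j) (zs.xC j) ≤ r := fun t j =>
    (dist_le_pi_dist _ _ j).trans (hb t).2.2.2.2.1
  have bxU : ∀ t j, dist ((z t).xU j) (zs.xU j) ≤ r := fun t j =>
    (dist_le_pi_dist _ _ j).trans (hb t).2.2.2.2.2.1
  have bpc : ∀ t j, dist ((z t).pc j) (zs.pc j) ≤ r := fun t j =>
    (dist_le_pi_dist _ _ j).trans (hb t).2.2.2.2.2.2.1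
  have hr0 : 0 ≤ r := dist_nonneg.trans (hb 0).1
  -- frequencies
  have hω : ∀ t j, (z t).ω j = zs.ω j := by
    intro t j
    have : (P.ζ (z t) j - P.ζ zs j).1 = 0 := by
      rcases hφ j with h | h
      · rw [h.eq_zero (hφ0 t j)]; rfl
      · exact h.2.1 _ (hφ0 t j)
    simp only [ζ, Prod.fst_sub] at this
    linarith
  have hηc : ∀ t, (z t).η = (z 0).η := by
    intro t
    funext e
    refine eq_of_hasDerivAt_zero (f := fun t => (z t).η e) (fun t => ?_) t 0
    refine ((hsol' t).1 e).congr_deriv ?_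
    rw [hω, hω]
    exact hzs.η e
  have hxU : ∀ t j, (z t).xU j = zs.xU j := by
    intro t j
    rw [hzs.xU_eq j]
    refine (hr.xU j).eq_kx (isCompact_closedBall _ _) (y := fun t => (z t).xU j) (fun t => ?_)
      (fun t => bxU t j) t
    have := (hsol' t).2.2.2.2.2.1 j
    rwa [hω] at this
  have hduc : ∀ t j, P.du (z t) j = P.du (z 0) j := fun t j => by
    simp only [du, hxU t j, hω t j, hxU 0 j, hω 0 j]
  have hnf : ∀ t j, P.netFlow (z t) j = P.netFlow (z 0) j := fun t j => by
    simp only [netFlow, flow, hηc t]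
  have hsw : ∀ t j, P.swing (z t) j = 0 := by
    intro t j
    cases j with
    | inl j =>
      have h1 := (hsol' t).2.2.1 j
      have h2 : HasDerivAt (fun r => (z r).ω (Sum.inl j)) 0 t := by
        simp only [hω]
        exact hasDerivAt_const _ _
      have := h1.unique h2
      exact (div_eq_zero_iff.1 this).resolve_right (P.M_pos j).ne'
    | inr j => exact (hcons t).1 j
  -- The swing expression vanishes identically while demand and flows are frozen, so supply is the
  -- only term left and must be constant too.
  have hs : ∀ t j, P.supply (z t) j = P.supply (z 0) j := by
    intro t j
    have h1 := hsw t j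
    have h2 := hsw 0 j
    unfold swing at h1 h2
    linarith [hduc t j, hnf t j]
  have hχ : ∀ t j, (z t).χ j = P.pL j := by
    intro t j
    cases j with
    | inl j => rw [hχ0, hzs.χ_eq]
    | inr j => exact (consistent_iff.1 (hcons t)).2 j
  have hobs : ∀ t j, P.obsSwing (z t) j = 0 := by
    intro t j
    have h1 := hsw t j
    unfold swing at h1
    unfold obsSwing
    linarith [hχ t j]
  -- power command at the buses with inertia
  have hbc : ∀ t j, (z t).b j = (z 0).b j := by
    intro t j
    refine eq_of_hasDerivAt_zero (f := fun t => (z t).b j) (fun t => ?_) t 0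
    refine ((hsol' t).2.2.2.2.2.2.2.1 j).congr_deriv ?_
    rw [hobs, zero_div]
  have hobsχ : ∀ t j, P.obsχ (z t) j = 0 := by
    intro t j
    have h1 := (hsol' t).2.2.2.2.2.2.2.2 j
    have h2 : HasDerivAt (fun r => (z r).χ (Sum.inl j)) 0 t := by
      simp only [hχ]
      exact hasDerivAt_const _ _
    exact (div_eq_zero_iff.1 (h1.unique h2)).resolve_right (P.τ_pos j).ne'
  have hζ : ∀ t j, P.ζ (z t) j = (-zs.ω j, (z t).pc j) := fun t j => by simp only [ζ, hω]
  -- power command at the load buses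
  have hsin : ∀ j, IsSinusoidSum fun t => (z t).pc j := by
    refine isSinusoidSum_of_network (fun e : P.Ec => e.1.1) (fun e => e.1.2) P.γ_pos P.γc_pos
      (fun j => -(P.supply (z 0) j - P.pL j)) (p := fun t => (z t).pc) (ψ := fun t => (z t).ψ)
      (fun t j => ?_) (fun t e => (hsol' t).2.1 e) (R := ‖zs.pc‖ + r) (fun t j => ?_)
    · have := (hsol' t).2.2.2.2.2.2.1 j
      rwa [command, hs, hχ, netψ] at this
    · have h1 := bpc t j
      have h2 := norm_le_pi_norm zs.pc j
      rw [Real.dist_eq] at h1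
      rw [Real.norm_eq_abs] at h2
      have := abs_sub_abs_le_abs_sub ((z t).pc j) (zs.pc j)
      linarith
  have hdistζ : ∀ t j, dist (-zs.ω j, (z t).pc j) (P.ζ zs j) ≤ r := by
    intro t j
    simp only [ζ, Prod.dist_eq, dist_self]
    exact max_le hr0 (bpc t j)
  have hpcφ : ∀ t j, PosDefFun (φ j) → (z t).pc j = zs.pc j := by
    intro t j h
    have := congrArg Prod.snd (h.eq_zero (hφ0 t j))
    simp only [ζ, Prod.snd_sub, Prod.snd_zero] at this
    linarith
  -- With inertia, the observer equation reads `0 = b - ω - p^c - χ` with all other terms constant.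
  -- At a load bus, `p^c` is either pinned by `φ` or a sinusoid sum that is not allowed to vary.
  have hpc : ∀ t j, (z t).pc j = (z 0).pc j := by
    intro t j
    cases j with
    | inl j =>
      have h1 := hobsχ t j
      have h2 := hobsχ 0 j
      unfold obsχ at h1 h2
      linarith [hbc t j, hω t (Sum.inl j), hω 0 (Sum.inl j), hχ t (Sum.inl j), hχ 0 (Sum.inl j)]
    | inr j =>
      rcases hr.noSinusoid j with h | h
      · rw [hpcφ t _ h, hpcφ 0 _ h]
      · have := h (P.supply (z 0) (Sum.inr j)) (fun t => (z t).pc (Sum.inr j))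
          (fun t => (z t).xC (Sum.inr j)) (fun t => ⟨hdistζ t _, bxC t _⟩)
          (fun t => by
            have := (hsol' t).2.2.2.2.1 (Sum.inr j)
            rwa [hζ] at this)
          (fun t => by
            have := hs t (Sum.inr j)
            rw [← this, supply, dc, hζ])
        simp only [IsNontrivialSinusoid, not_and, not_not] at this
        obtain ⟨c, hc⟩ := this (hsin _)
        rw [hc t, hc 0]
  have hψ : ∀ e : P.Ec, (z 0).pc e.1.1 - (z 0).pc e.1.2 = 0 := by
    intro e
    have h1 : ∀ t, HasDerivAt (fun r => (z r).ψ e)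
        (((z 0).pc e.1.1 - (z 0).pc e.1.2) / P.γc e) t := by
      intro t
      have := (hsol' t).2.1 e
      rwa [hpc t, hpc t] at this
    -- Constant commands would make `ψ` drift at constant speed, which boundedness forbids; hence
    -- the commands agree across each communication line.
    have h2 := eq_zero_of_hasDerivAt_const_of_bounded h1 (R := |zs.ψ e| + r) (fun t => by
      have h1 := bψ t e
      rw [Real.dist_eq] at h1
      have := abs_sub_abs_le_abs_sub ((z t).ψ e) (zs.ψ e)
      linarith)
    exact (div_eq_zero_iff.1 h2).resolve_right (P.γc_pos e).ne'
  have hpceq : ∀ i j, (z 0).pc i = (z 0).pc j :=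
    const_of_connected P.Ec_connected
      (fun i j (h : (i, j) ∈ P.Ec) => sub_eq_zero.1 (hψ ⟨(i, j), h⟩))
  have hζc : ∀ t j, P.ζ (z t) j = P.ζ (z 0) j := fun t j => by rw [hζ, hζ, hpc]
  -- One positive definite `φ i` fixes `p^c` at bus `i`, and the uniformity of `p^c` carries the
  -- value to all buses.
  have hζs : ∀ j, (∃ i, PosDefFun (φ i)) → P.ζ (z 0) j = P.ζ zs j := by
    rintro j ⟨i, hi⟩
    rw [hζ, hpceq j i, hpcφ 0 i hi, hzs.pc_eq i j, ζ]
  have hcom : ∀ j, P.command (z 0) j = 0 := by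
    intro j
    have h1 := (hsol' 0).2.2.2.2.2.2.1 j
    have h2 : HasDerivAt (fun r => (z r).pc j) 0 0 := by
      have : (fun r => (z r).pc j) = fun _ => (z 0).pc j := funext fun t => hpc t j
      rw [this]
      exact hasDerivAt_const _ _
    exact (div_eq_zero_iff.1 (h1.unique h2)).resolve_right (P.γ_pos j).ne'
  have hxM : ∀ j, (z 0).xM j = (P.sysM j).kx (P.ζ (z 0) (Sum.inl j)) := by
    intro j
    refine (hr.xM j _ ?_ (hζs _)).eq_kx (isCompact_closedBall _ _) (y := fun t => (z t).xM j)
      (fun t => ?_) (fun t => bxM t j) 0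
    · rw [hζ]; exact hdistζ 0 _
    · have := (hsol' t).2.2.2.1 j
      rwa [hζc] at this
  have hxC : ∀ j, (z 0).xC j = (P.sysC j).kx (P.ζ (z 0) j) := by
    intro j
    refine (hr.xC j _ ?_ (hζs _)).eq_kx (isCompact_closedBall _ _) (y := fun t => (z t).xC j)
      (fun t => ?_) (fun t => bxC t j) 0
    · rw [hζ]; exact hdistζ 0 _
    · have := (hsol' t).2.2.2.2.1 j
      rwa [hζc] at this
  exact
    { η := fun e => by rw [hω, hω]; exact hzs.η e
      ω := fun j => hsw 0 _
      xM := fun j => by rw [hxM]; exact (P.sysM j).f_kx _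
      xC := fun j => by rw [hxC]; exact (P.sysC j).f_kx _
      xU := fun j => by rw [hxU, hω]; exact hzs.xU j
      ψ := hψ
      pc := hcom
      χ := hobsχ 0
      b := fun j => hobs 0 _
      alg := hcons 0 }

end PowerNetwork

/-! ### Elimination of the load variables and the reduced Lyapunov system -/

/-- A curve in the closed half ball whenever it is in the ball cannot leave the ball. -/
theorem mem_ball_of_preconnected {Y : Type*} [PseudoMetricSpace Y] {y : ℝ → Y} {I : Set ℝ}
    (hI : IsPreconnected I) (hy : ContinuousOn y I) {c : Y} {ρ : ℝ} {t₀ : ℝ}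
    (ht₀ : t₀ ∈ I) (h0 : y t₀ ∈ Metric.ball c ρ)
    (h : ∀ t ∈ I, y t ∈ Metric.ball c ρ → y t ∈ Metric.closedBall c (ρ / 2)) :
    ∀ t ∈ I, y t ∈ Metric.ball c ρ := by
  by_contra! hcon
  obtain ⟨t, ht, hyt⟩ := hcon
  have hρ : 0 < ρ := Metric.pos_of_mem_ball h0
  have hsub : Metric.closedBall c (ρ / 2) ⊆ Metric.ball c ρ :=
    Metric.closedBall_subset_ball (by linarith)
  obtain ⟨_, ⟨s, hs, rfl⟩, h1, h2⟩ := hI.image y hy (Metric.ball c ρ)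
    (Metric.closedBall c (ρ / 2))ᶜ Metric.isOpen_ball Metric.isClosed_closedBall.isOpen_compl
    (fun x _ => by
      by_cases hx : x ∈ Metric.closedBall c (ρ / 2)
      · exact Or.inl (hsub hx)
      · exact Or.inr hx)
    ⟨_, mem_image_of_mem y ht₀, h0⟩
    ⟨_, mem_image_of_mem y ht, fun hx => hyt (hsub hx)⟩
  exact h2 (h s hs h1)

namespace PowerNetwork

variable {G L : Type} [Fintype G] [Fintype L] [DecidableEq G] [DecidableEq L]
variable {P : PowerNetwork G L}

/-- The type of the arguments of the function that gives the load frequencies. -/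
abbrev AlgInput (P : PowerNetwork G L) : Type :=
  (P.E → ℝ) × (G → ℝ) × (∀ j : G ⊕ L, (P.sysC j).X) × (∀ j : G ⊕ L, (P.sysU j).X) ×
    (G ⊕ L → ℝ)

/-- The arguments of the function that gives the load frequencies, from the reduced state. -/
def algReduced (x : P.Reduced) : P.AlgInput :=
  (x.1, x.2.2.1, x.2.2.2.2.1, x.2.2.2.2.2.1, x.2.2.2.2.2.2.1)

theorem continuous_algReduced : Continuous (algReduced : P.Reduced → P.AlgInput) := by
  unfold algReduced
  fun_prop

/-- The state with the given differential variables, whose load frequencies are given by `fL`. -/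
def lift (fL : P.AlgInput → L → ℝ) (x : P.Reduced) : P.State where
  η := x.1
  ψ := x.2.1
  ω := Sum.elim x.2.2.1 (fL (algReduced x))
  xM := x.2.2.2.1
  xC := x.2.2.2.2.1
  xU := x.2.2.2.2.2.1
  pc := x.2.2.2.2.2.2.1
  b := x.2.2.2.2.2.2.2.1
  χ := Sum.elim x.2.2.2.2.2.2.2.2 fun j => P.pL (Sum.inr j)

theorem lift_reduce {fL : P.AlgInput → L → ℝ} {z : P.State} (hz : P.Consistent z)
    (hω : P.ωL z = fL (P.algInput z)) : lift fL (P.reduce z) = z := by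
  have hχ := (consistent_iff.1 hz).2
  ext j
  · rfl
  · rfl
  · cases j with
    | inl j => rfl
    | inr j => exact (congrFun hω j).symm
  · rfl
  · rfl
  · rfl
  · rfl
  · rfl
  · cases j with
    | inl j => rfl
    | inr j => exact (hχ j).symm

theorem continuousOn_lift {fL : P.AlgInput → L → ℝ} {s : Set P.Reduced}
    (h : ContinuousOn (fun x => fL (algReduced x)) s) : ContinuousOn (lift fL) s :=
  continuousOn_state continuousOn_id h
    (continuousOn_const (c := fun j : L => P.pL (Sum.inr j)))

/-- On the closed ball of radius `r` the system is equivalent to an ordinary differential equation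
with a Lyapunov function. -/
structure LocalReduction (zs : P.State) (fL : P.AlgInput → L → ℝ) (ρ r : ℝ) : Prop where
  cont : ContinuousOn (lift fL) (Metric.closedBall (P.reduce zs) r)
  consistent : ∀ x ∈ Metric.closedBall (P.reduce zs) r, P.Consistent (lift fL x)
  near : ∀ x ∈ Metric.closedBall (P.reduce zs) r,
    fL (algReduced x) ∈ Metric.closedBall (P.ωL zs) (ρ / 2)
  eq_lift : ∀ z, P.reduce z ∈ Metric.closedBall (P.reduce zs) r →
    P.ωL z ∈ Metric.ball (P.ωL zs) ρ → P.Consistent z → lift fL (P.reduce z) = z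

theorem LoadFrequencyRegular.eventually_localReduction {zs : P.State} (hzs : P.IsEquilibrium zs)
    (h : P.LoadFrequencyRegular zs) :
    ∃ (fL : P.AlgInput → L → ℝ) (ρ : ℝ), 0 < ρ ∧ lift fL (P.reduce zs) = zs ∧
      ContinuousAt (lift fL) (P.reduce zs) ∧ ∀ᶠ r in 𝓝 (0 : ℝ), LocalReduction zs fL ρ r := by
  obtain ⟨T, O, fL, hT, hzT, hO, hzO, hlip, hiff⟩ := h
  obtain ⟨ρ, hρ, hρO⟩ := Metric.isOpen_iff.1 hO _ hzO
  have hfix : P.ωL zs = fL (P.algInput zs) := (hiff zs hzT hzO).1 hzs.alg.1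
  have hTo : IsOpen (algReduced ⁻¹' T : Set P.Reduced) := hT.preimage continuous_algReduced
  have hcont : ContinuousOn (fun x => fL (algReduced x)) (algReduced ⁻¹' T : Set P.Reduced) :=
    hlip.continuousOn.comp continuous_algReduced.continuousOn (fun _ hx => hx)
  have hTn : (algReduced ⁻¹' T : Set P.Reduced) ∈ 𝓝 (P.reduce zs) := hTo.mem_nhds hzT
  refine ⟨fL, ρ, hρ, lift_reduce hzs.alg hfix, (continuousOn_lift hcont).continuousAt hTn, ?_⟩
  -- The half radius leaves a gap: load frequencies given by `fL` stay away from the boundary of the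
  -- `ρ`-ball, so a continuous solution cannot switch to another branch of the power balance.
  have hnear : ∀ᶠ x in 𝓝 (P.reduce zs), fL (algReduced x) ∈ Metric.closedBall (P.ωL zs) (ρ / 2) := by
    refine (hcont.continuousAt hTn).eventually_mem ?_
    have : fL (algReduced (P.reduce zs)) = P.ωL zs := hfix.symm
    rw [this]
    exact Metric.closedBall_mem_nhds _ (by positivity)
  filter_upwards [eventually_closedBall_subset hTn, eventually_closedBall_subset hnear]
    with r hr1 hr2
  have hsub : Metric.closedBall (P.ωL zs) (ρ / 2) ⊆ O :=
    (Metric.closedBall_subset_ball (by linarith)).trans hρO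
  refine ⟨continuousOn_lift (hcont.mono hr1), fun x hx => ?_, hr2, fun z hz hω hcons => ?_⟩
  · exact consistent_iff.2 ⟨(hiff (lift fL x) (hr1 hx) (hsub (hr2 hx))).2 rfl, fun j => rfl⟩
  · exact lift_reduce hcons ((hiff z (hr1 hz) (hρO hω)).1 hcons.1)

/-- Near the equilibrium the reduced system has a Lyapunov function, and the complete solutions
along which it is constant are equilibria. -/
theorem exists_lyapunovPair {zs : P.State} (hzs : P.IsEquilibrium zs)
    (hη : ∀ e, |zs.η e| < Real.pi / 2) (hreg : P.LoadFrequencyRegular zs)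
    {φ : G ⊕ L → ℝ × ℝ → ℝ} (hdiss : ∀ j, P.BusDissipative zs (φ j) j)
    (hφ : ∀ j, PosDefFun (φ j) ∨ (PosDefFstFun (φ j) ∧ P.BusNoSinusoid zs j))
    (hbasin : (∃ j, PosDefFun (φ j)) ∨
      ((∀ j, (P.sysM j).CommonBasin (P.ζ zs (Sum.inl j))) ∧
        ∀ j, (P.sysC j).CommonBasin (P.ζ zs j))) :
    ∃ (fL : P.AlgInput → L → ℝ) (ρ r c : ℝ) (V : P.Reduced → ℝ), 0 < ρ ∧
      LocalReduction zs fL ρ r ∧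
      LyapunovPair (fun x => P.field (lift fL x)) V (P.reduce zs) r c ∧
      P.reduce zs ∈ LyapunovPair.sublevel V (P.reduce zs) r c ∧
      ∀ y : ℝ → P.Reduced, (∀ t, HasDerivAt y (P.field (lift fL (y t))) t ∧
        y t ∈ Metric.closedBall (P.reduce zs) r) → (∀ t, V (y t) = V (y 0)) →
        P.IsEquilibrium (lift fL (y 0)) := by
  obtain ⟨fL, ρ, hρ, hlift, hliftc, hred⟩ := hreg.eventually_localReduction hzs
  obtain ⟨V, hVc, hVpos, hV0, hVd⟩ := exists_lyapunov hzs hη hdiss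
  have hev : ∀ {p : P.State → Prop}, (∀ᶠ z in 𝓝 zs, p z) →
      ∀ᶠ r in 𝓝 (0 : ℝ), Metric.closedBall (P.reduce zs) r ⊆ {x | p (lift fL x)} := by
    intro p hp
    refine eventually_closedBall_subset ?_
    rw [← hlift] at hp
    exact hliftc.eventually hp
  obtain ⟨r, ⟨hr, hsmall, hpos, hdec⟩, hr0⟩ := (((hred.and ((eventually_smallRadius hzs hφ hbasin).and
    ((hev hVpos).and (hev hVd)))).filter_mono nhdsWithin_le_nhds).and
    (self_mem_nhdsWithin : Ioi (0 : ℝ) ∈ 𝓝[>] 0)).exists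
  have hr0 : 0 < r := hr0
  have hφnn : ∀ j ζ, 0 ≤ φ j ζ := fun j ζ => by
    rcases hφ j with h | h
    · exact h.nonneg ζ
    · exact h.1.1 ζ
  have hVlift : ContinuousOn (fun x => V (lift fL x)) (Metric.closedBall (P.reduce zs) r) :=
    hVc.comp_continuousOn hr.cont
  -- The level `c` is the minimum of `V` on the compact sphere, positive because `V` vanishes only
  -- at the center; on an empty sphere any positive level does.
  obtain ⟨c, hc0, hc⟩ : ∃ c > 0, ∀ x ∈ Metric.sphere (P.reduce zs) r, c ≤ V (lift fL x) := by
    rcases (Metric.sphere (P.reduce zs) r).eq_empty_or_nonempty with h | h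
    · exact ⟨1, one_pos, fun x hx => by simp [h] at hx⟩
    · obtain ⟨x, hx, hmin⟩ := (isCompact_sphere (P.reduce zs) r).exists_isMinOn h
        (hVlift.mono Metric.sphere_subset_closedBall)
      have hp := hpos (Metric.sphere_subset_closedBall hx)
      refine ⟨V (lift fL x), lt_of_le_of_ne hp.1 fun h0 => ?_, fun y hy => hmin hy⟩
      have h1 : x = P.reduce zs := hp.2 h0.symm
      rw [h1, Metric.mem_sphere, dist_self] at hx
      exact hr0.ne hx
  have hderiv : ∀ (x : ℝ → P.Reduced) (s : Set ℝ) (t : ℝ),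
      x t ∈ Metric.closedBall (P.reduce zs) r →
      HasDerivWithinAt x (P.field (lift fL (x t))) s t →
      ∃ d ≤ -(∑ j, φ j (P.ζ (lift fL (x t)) j - P.ζ zs j) +
          ∑ j : G, ((lift fL (x t)).χ (Sum.inl j) - zs.χ (Sum.inl j)) ^ 2),
        HasDerivWithinAt (fun r => V (lift fL (x r))) d s t := fun x s t hx hd =>
    hdec hx (hr.consistent _ hx) (fun r => lift fL (x r)) s t rfl hd
  refine ⟨fL, ρ, r, c, fun x => V (lift fL x), hρ, hr,
    ⟨hr0, continuous_field.comp_continuousOn hr.cont, hVlift, fun x s t hx hd => ?_, hc⟩,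
    ⟨Metric.mem_ball_self hr0, ?_⟩, fun y hy hVy => ?_⟩
  · obtain ⟨d, hd1, hd2⟩ := hderiv x s t hx hd
    refine ⟨d, hd1.trans ?_, hd2⟩
    have h1 := Finset.sum_nonneg fun j (_ : j ∈ Finset.univ) =>
      hφnn j (P.ζ (lift fL (x t)) j - P.ζ zs j)
    have h2 : 0 ≤ ∑ j : G, ((lift fL (x t)).χ (Sum.inl j) - zs.χ (Sum.inl j)) ^ 2 :=
      Finset.sum_nonneg fun j _ => sq_nonneg _
    linarith
  · simp only [hlift, hV0]
    exact hc0
  · have hzero : ∀ t, (∀ j, φ j (P.ζ (lift fL (y t)) j - P.ζ zs j) = 0) ∧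
        ∀ j : G, (lift fL (y t)).χ (Sum.inl j) = zs.χ (Sum.inl j) := by
      intro t
      obtain ⟨d, hd1, hd2⟩ := hderiv y univ t (hy t).2 (hy t).1.hasDerivWithinAt
      have hd3 : HasDerivAt (fun r => V (lift fL (y r))) 0 t := by
        have : (fun r => V (lift fL (y r))) = fun _ => V (lift fL (y 0)) := funext hVy
        rw [this]
        exact hasDerivAt_const _ _
      -- The derivative of `V` is zero and is bounded above by minus a sum of nonnegative terms, so
      -- each term vanishes.
      have hd0 : d = 0 := (hasDerivWithinAt_univ.1 hd2).unique hd3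
      have p1 : ∀ j ∈ (Finset.univ : Finset (G ⊕ L)),
          0 ≤ φ j (P.ζ (lift fL (y t)) j - P.ζ zs j) := fun j _ => hφnn j _
      have p2 : ∀ j ∈ (Finset.univ : Finset G),
          0 ≤ ((lift fL (y t)).χ (Sum.inl j) - zs.χ (Sum.inl j)) ^ 2 := fun j _ => sq_nonneg _
      have s1 := Finset.sum_nonneg p1
      have s2 := Finset.sum_nonneg p2
      have z1 := (Finset.sum_eq_zero_iff_of_nonneg p1).1 (by linarith)
      have z2 := (Finset.sum_eq_zero_iff_of_nonneg p2).1 (by linarith)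
      exact ⟨fun j => z1 j (Finset.mem_univ j), fun j =>
        sub_eq_zero.1 (pow_eq_zero_iff two_ne_zero |>.1 (z2 j (Finset.mem_univ j)))⟩
    exact isEquilibrium_of_invariant hzs (fun j => (hφ j).imp_right And.left) hsmall
      (z := fun t => lift fL (y t)) (fun t => (hy t).1.hasDerivWithinAt)
      (fun t => hr.consistent _ (hy t).2) (fun t => (hy t).2) (fun t => (hzero t).1)
      (fun t => (hzero t).2)

/-- Solutions that start near the equilibrium are solutions of the reduced system. -/
theorem LocalReduction.mem_sublevel {zs : P.State} {fL : P.AlgInput → L → ℝ} {ρ r c : ℝ}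
    {V : P.Reduced → ℝ} (h : LocalReduction zs fL ρ r)
    (hV : LyapunovPair (fun x => P.field (lift fL x)) V (P.reduce zs) r c) {z : ℝ → P.State}
    {I : Set ℝ} (hI : ∀ t ∈ I, 0 ≤ t ∧ Icc 0 t ⊆ I) (hz : P.IsSolutionOn z I)
    (h0 : P.reduce (z 0) ∈ LyapunovPair.sublevel V (P.reduce zs) r c)
    (hω0 : P.ωL (z 0) ∈ Metric.ball (P.ωL zs) ρ) :
    ∀ t ∈ I, P.reduce (z t) ∈ LyapunovPair.sublevel V (P.reduce zs) r c ∧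
      lift fL (P.reduce (z t)) = z t := by
  obtain ⟨hc, hsol⟩ := isSolutionOn_iff.1 hz
  have hωc : ContinuousOn (fun t => P.ωL (z t)) I := by
    have : Continuous P.ωL := by
      unfold ωL
      fun_prop
    exact this.comp_continuousOn hc
  -- As long as the reduced state stays in the ball, connectedness in time keeps the load
  -- frequencies on the branch `fL`, so the solution is the lift of its reduced part.
  have key : ∀ J : Set ℝ, IsPreconnected J → J ⊆ I → 0 ∈ J →
      (∀ t ∈ J, P.reduce (z t) ∈ Metric.closedBall (P.reduce zs) r) →
      ∀ t ∈ J, lift fL (P.reduce (z t)) = z t := by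
    intro J hJ hJI hJ0 hball t ht
    refine h.eq_lift _ (hball t ht) ?_ (hsol t (hJI ht)).2
    refine mem_ball_of_preconnected hJ (hωc.mono hJI) hJ0 hω0 (fun s hs hsb => ?_) t ht
    rw [← h.eq_lift _ (hball s hs) hsb (hsol s (hJI hs)).2]
    exact h.near _ (hball s hs)
  intro T hT
  obtain ⟨hT0, hTI⟩ := hI T hT
  have hmem : ∀ t ∈ Icc 0 T, P.reduce (z t) ∈ LyapunovPair.sublevel V (P.reduce zs) r c := by
    refine hV.mem_sublevel (x := fun t => P.reduce (z t))
      (continuous_reduce.comp_continuousOn (hc.mono hTI)) h0 ?_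
    intro t₁ ht₁ hball t ht
    have hsub : Ico 0 t₁ ⊆ I := fun s hs => hTI ⟨hs.1, hs.2.le.trans ht₁.2⟩
    have := key (Ico 0 t₁) isPreconnected_Ico hsub ⟨le_rfl, ht.1.trans_lt ht.2⟩
      (fun s hs => Metric.ball_subset_closedBall (hball s hs)) t ht
    simp only [this]
    exact (hsol t (hsub ht)).1.mono hTI
  exact ⟨hmem T ⟨hT0, le_rfl⟩, key (Icc 0 T) isPreconnected_Icc hTI ⟨le_rfl, hT0⟩
    (fun s hs => LyapunovPair.sublevel_subset (hmem s hs)) T ⟨hT0, le_rfl⟩⟩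

theorem LocalReduction.isSolutionOn {zs : P.State} {fL : P.AlgInput → L → ℝ} {ρ r : ℝ}
    (h : LocalReduction zs fL ρ r) {x : ℝ → P.Reduced} {I : Set ℝ}
    (hx : ∀ t ∈ I, HasDerivWithinAt x (P.field (lift fL (x t))) I t ∧
      x t ∈ Metric.closedBall (P.reduce zs) r) :
    P.IsSolutionOn (fun t => lift fL (x t)) I :=
  isSolutionOn_iff.2 ⟨h.cont.comp (fun t ht => (hx t ht).1.continuousWithinAt)
    (fun t ht => (hx t ht).2), fun t ht => ⟨(hx t ht).1, h.consistent _ (hx t ht).2⟩⟩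

end PowerNetwork
-- Existence, extension and convergence for the network
theorem proposition1 {G L : Type} [Fintype G] [Fintype L] [DecidableEq G] [DecidableEq L]
    (P : PowerNetwork G L) (Q : OSLC G L)
    -- costs are continuously differentiable and strictly convex
    (hC : ∀ j, ContDiff ℝ 1 (Q.C j) ∧ StrictConvexOn ℝ univ (Q.C j))
    (hCd : ∀ j, ContDiff ℝ 1 (Q.Cd j) ∧ StrictConvexOn ℝ univ (Q.Cd j))
    -- the static characteristics match the costs
    (hspec : Q.ControlSpec P)
    -- uncontrollable demand: negative feedback at steady state
    (hdu : ∀ j, ∀ u : ℝ, u ≠ 0 → 0 < u * (P.sysU j).ky u)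
    -- the equilibrium under consideration
    (zs : P.State) (hzs : P.IsEquilibrium zs)
    (hη : ∀ e, |zs.η e| < Real.pi / 2)
    (hreg : P.LoadFrequencyRegular zs)
    -- dissipativity at every bus
    (φ : G ⊕ L → ℝ × ℝ → ℝ)
    (hdiss : ∀ j, P.BusDissipative zs (φ j) j)
    (hφ : ∀ j, PosDefFun (φ j) ∨ (PosDefFstFun (φ j) ∧ P.BusNoSinusoid zs j))
    -- if no `φ j` is positive definite: regions of attraction do not shrink near the equilibrium
    (hbasin : (∃ j, PosDefFun (φ j)) ∨
      ((∀ j, (P.sysM j).CommonBasin (P.ζ zs (Sum.inl j))) ∧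
        ∀ j, (P.sysC j).CommonBasin (P.ζ zs j))) :
    ∃ O : Set P.State, IsOpen O ∧ zs ∈ O ∧ ∀ z₀ ∈ O,
      -- solutions exist for all times
      (P.Consistent z₀ → ∃ z : ℝ → P.State, P.IsSolutionOn z (Ici 0) ∧ z 0 = z₀) ∧
      (∀ τ > 0, ∀ z : ℝ → P.State, P.IsSolutionOn z (Ico 0 τ) → z 0 = z₀ →
        ∃ z' : ℝ → P.State, P.IsSolutionOn z' (Ici 0) ∧ EqOn z z' (Ico 0 τ)) ∧
      -- and converge to optimal equilibria with nominal frequency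
      (∀ z : ℝ → P.State, P.IsSolutionOn z (Ici 0) → z 0 = z₀ →
        Tendsto z atTop (𝓝ˢ {e | P.IsEquilibrium e ∧ (∀ j, e.ω j = 0) ∧
          Q.IsGlobalMin P.pL (P.pM e) (P.dc e)}) ∧
        (∃ (p : G → ℝ) (d : G ⊕ L → ℝ), Q.IsGlobalMin P.pL p d ∧
          Tendsto (fun t => P.pM (z t)) atTop (𝓝 p) ∧
          Tendsto (fun t => P.dc (z t)) atTop (𝓝 d)) ∧
        Tendsto (fun t => (z t).ω) atTop (𝓝 0)) := by
  obtain ⟨fL, ρ, r, c, V, hρ, hred, hV, hmem, hequ⟩ :=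
    PowerNetwork.exists_lyapunovPair hzs hη hreg hdiss hφ hbasin
  have hωLc : Continuous P.ωL := by
    unfold PowerNetwork.ωL
    fun_prop
  have hmin : ∀ e, P.IsEquilibrium e → Q.IsGlobalMin P.pL (P.pM e) (P.dc e) := fun e he =>
    he.isGlobalMin hC hCd hspec
  -- The first condition traps the reduced state; the second selects the branch of load frequencies
  -- described by `fL`.
  refine ⟨{z | P.reduce z ∈ LyapunovPair.sublevel V (P.reduce zs) r c ∧
      P.ωL z ∈ Metric.ball (P.ωL zs) ρ},
    (hV.isOpen_sublevel.preimage PowerNetwork.continuous_reduce).inter (Metric.isOpen_ball.preimage hωLc),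
    ⟨hmem, Metric.mem_ball_self hρ⟩, ?_⟩
  rintro z₀ ⟨hz₀, hωz₀⟩
  refine ⟨fun hcons => ?_, fun τ hτ z hz h0 => ?_, fun z hz h0 => ?_⟩
  · obtain ⟨x, hx0, hx⟩ := hV.exists_solution hz₀
    refine ⟨fun t => PowerNetwork.lift fL (x t), hred.isSolutionOn fun t ht =>
      ⟨(hx t ht).1, LyapunovPair.sublevel_subset (hx t ht).2⟩, ?_⟩
    simp only [hx0]
    exact hred.eq_lift _ (LyapunovPair.sublevel_subset hz₀) hωz₀ hcons
  · subst h0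
    have hin := hred.mem_sublevel hV (I := Ico 0 τ)
      (fun t ht => ⟨ht.1, fun s hs => ⟨hs.1, hs.2.trans_lt ht.2⟩⟩) hz hz₀ hωz₀
    obtain ⟨y, hxy, hy⟩ := hV.exists_extension hτ (x := fun t => P.reduce (z t)) (fun t ht => by
      refine ⟨?_, (hin t ht).1⟩
      simp only [(hin t ht).2]
      exact ((PowerNetwork.isSolutionOn_iff.1 hz).2 t ht).1)
    refine ⟨fun t => PowerNetwork.lift fL (y t), hred.isSolutionOn fun t ht =>
      ⟨(hy t ht).1, LyapunovPair.sublevel_subset (hy t ht).2⟩, fun t ht => ?_⟩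
    have : P.reduce (z t) = y t := hxy ht
    simp only [← this, (hin t ht).2]
  · subst h0
    have hin := hred.mem_sublevel hV (I := Ici 0)
      (fun t ht => ⟨ht, fun s hs => hs.1⟩) hz hz₀ hωz₀
    have hx : ∀ t ∈ Ici (0 : ℝ), HasDerivWithinAt (fun t => P.reduce (z t))
        (P.field (PowerNetwork.lift fL (P.reduce (z t)))) (Ici 0) t ∧
        P.reduce (z t) ∈ LyapunovPair.sublevel V (P.reduce zs) r c := by
      intro t ht
      refine ⟨?_, (hin t ht).1⟩
      rw [(hin t ht).2]
      exact ((PowerNetwork.isSolutionOn_iff.1 hz).2 t ht).1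
    have hlim : Tendsto z atTop (𝓝ˢ {e | P.IsEquilibrium e ∧ (∀ j, e.ω j = 0) ∧
        Q.IsGlobalMin P.pL (P.pM e) (P.dc e)}) := by
      -- Along every ultrafilter finer than `atTop` the trapped solution has a limit, and LaSalle's
      -- principle identifies this limit as an equilibrium. This suffices for convergence to the
      -- set.
      rw [tendsto_iff_ultrafilter]
      intro U hU
      have hUin : ∀ᶠ t in (U : Filter ℝ),
          P.reduce (z t) ∈ Metric.closedBall (P.reduce zs) r := by
        filter_upwards [hU (Ici_mem_atTop 0)] with t ht
        exact LyapunovPair.sublevel_subset (hin t ht).1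
      obtain ⟨p, hp, hUp⟩ := (isCompact_closedBall (P.reduce zs) r).ultrafilter_le_nhds'
        (U.map fun t => P.reduce (z t)) hUin
      obtain ⟨y, hy0, hy, hVy⟩ := hV.exists_complete_solution hx U hU hUp
      have he := hequ y hy hVy
      rw [hy0] at he
      have hz' : Tendsto z U (𝓝 (PowerNetwork.lift fL p)) := by
        have h1 : Tendsto (fun t => P.reduce (z t)) (U : Filter ℝ)
            (𝓝[Metric.closedBall (P.reduce zs) r] p) := tendsto_nhdsWithin_iff.2 ⟨hUp, hUin⟩
        refine ((hred.cont p hp).tendsto.comp h1).congr' ?_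
        filter_upwards [hU (Ici_mem_atTop 0)] with t ht
        exact (hin t ht).2
      exact hz'.mono_right (nhds_le_nhdsSet ⟨he, he.ω_eq_zero hdu, hmin _ he⟩)
    -- A continuous quantity with the same value at all equilibria converges, even if the state has
    -- no limit. For `p^M` and `d^c` this uses uniqueness of the minimizer, for `ω` its vanishing at
    -- equilibrium.
    have hcomp : ∀ {Y : Type} [TopologicalSpace Y] (g : P.State → Y) (y : Y), Continuous g →
        (∀ e, P.IsEquilibrium e → g e = y) → Tendsto (fun t => g (z t)) atTop (𝓝 y) := by
      intro Y _ g y hg hgy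
      have : Tendsto g (𝓝ˢ {e | P.IsEquilibrium e ∧ (∀ j, e.ω j = 0) ∧
          Q.IsGlobalMin P.pL (P.pM e) (P.dc e)}) (𝓝 y) := by
        refine fun s hs => mem_nhdsSet_iff_forall.2 fun e he => hg.continuousAt ?_
        rwa [hgy e he.1]
      exact this.comp hlim
    have hun := fun e (he : P.IsEquilibrium e) =>
      (hmin e he).unique (fun j => (hC j).2) (fun j => (hCd j).2) (hmin zs hzs)
    exact ⟨hlim, ⟨P.pM zs, P.dc zs, hmin zs hzs,
      hcomp _ _ PowerNetwork.continuous_pM fun e he => (hun e he).1,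
      hcomp _ _ PowerNetwork.continuous_dc fun e he => (hun e he).2⟩,
      hcomp _ _ PowerNetwork.continuous_ω fun e he => funext (he.ω_eq_zero hdu)⟩
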